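/- Let $\mathbb{H}=\{\tau\in\mathbb{C} : \operatorname{Im}\tau>0\}$ and let $\eta(\tau)=e^{2\pi i\tau/24}\prod_{n=1}^{\infty}(1-e^{2\pi i n\tau})$ be the Dedekind eta function. Let $\left(\frac{n}{3}\right)$ be the Legendre symbol, equal to $1$, $-1$, $0$ according as $n\equiv 1,-1,0 \pmod 3$. For positive integers $j,k,n$ let $d^{*}_{j,k}(n)$ be the number of positive divisors $d$ of $n$ such that $d\equiv j\pmod k$ and $n/d$ is odd. Then for every $\tau\in\mathbb{H}$, with both series converging absolutely, $$\frac{\eta^5(2\tau)}{\eta^2(\tau)}=\sum_{n=1}^{\infty}(-1)^{n-1}\,n\left(\frac{n}{3}\right)\exp\left(\frac{2\pi i n^2\tau}{3}\right)$$ and $$\frac{\eta(\tau)\,\eta^6(6\tau)}{\eta^2(2\tau)\,\eta^3(3\tau)}=\sum_{n=1}^{\infty}\bigl(d^{*}_{1,3}(n)-d^{*}_{2,3}(n)\bigr)q^n,\qquad q=\exp(2\pi i\tau).$$ -/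

import Mathlib

/-- `dStar j k n` is the number of positive divisors `d` of `n` such that
`d ≡ j (mod k)` and `n / d` is odd. -/
def dStar (j k n : ℕ) : ℕ :=
  (n.divisors.filter fun d => d ≡ j [MOD k] ∧ Odd (n / d)).card

/-! Both identities come from multiplying a theta series by another bilateral series and regrouping
by total degree. Convergence over `ℕ+` is unconditional, hence absolute in `ℂ`.

First identity: multiply ∑ q^(m²) by Jacobi's series ∑ (-1)^n (2n+1) q^(2n(n+1)) and group by N = m
+ 2n. As ∑ m q^(m²) = 0, the weight 2n+1 may be replaced by N+1. Completing the square modulo 3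
turns each inner sum into a pentagonal series (N ≡ 0, 1) or a vanishing theta series (N ≡ 2). The
two surviving classes agree, which evaluates ∑ (3k+1)(-1)^k q^(3k²+2k) as a product
(`tsum_linear_mul_neg_one_zpow`); then n = |3k+1| gives the stated series.

Second identity: the divisor sum is q ∑ y^m/(1-p^(2m+1)) over all integers m, with p = q³ and y = q²
(`tsum_divisorTerm`). The theta series θ(y) = ∑ (-1)^n p^(n(n+1)) y^n times this Lambert series has
coefficients satisfying the first-order recurrence of c·θ(py), because θ(1) = 0. The constant c
follows from Jacobi's cube identity (`thetaLambert_zero_mul`), and the triple product makes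
everything a quotient of products. -/

open Filter Topology

/-! ### q-Pochhammer symbols and their finite truncations -/

/-- The infinite `q`-Pochhammer symbol `(a; q)_∞`. -/
noncomputable def qPochInf (a q : ℂ) : ℂ := ∏' i : ℕ, (1 - a * q ^ i)

/-- The finite product `(q; q)_n`. -/
noncomputable def qFactorial (q : ℂ) (n : ℕ) : ℂ := ∏ i ∈ Finset.range n, (1 - q ^ (i + 1))

/-- The reciprocal of `(q; q)_m`, extended by zero to negative `m`. -/
noncomputable def invQFactorial (q : ℂ) (m : ℤ) : ℂ :=
  if 0 ≤ m then (qFactorial q m.toNat)⁻¹ else 0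

theorem one_sub_mul_pow_ne_zero {a q : ℂ} (ha : ‖a‖ < 1) (hq : ‖q‖ < 1) (i : ℕ) :
    1 - a * q ^ i ≠ 0 := by
  intro h
  have h1 : a * q ^ i = 1 := (sub_eq_zero.mp h).symm
  have h2 : ‖a‖ * ‖q‖ ^ i = 1 := by rw [← norm_pow, ← norm_mul, h1, norm_one]
  have h3 : ‖q‖ ^ i ≤ 1 := pow_le_one₀ (norm_nonneg _) hq.le
  nlinarith [norm_nonneg a]

theorem summable_norm_neg_mul_pow (a : ℂ) {q : ℂ} (hq : ‖q‖ < 1) :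
    Summable fun i : ℕ => ‖-(a * q ^ i)‖ := by
  simpa using (summable_geometric_of_lt_one (norm_nonneg q) hq).mul_left ‖a‖

theorem multipliable_one_sub_mul_pow (a : ℂ) {q : ℂ} (hq : ‖q‖ < 1) :
    Multipliable fun i : ℕ => 1 - a * q ^ i := by
  simpa [sub_eq_add_neg] using multipliable_one_add_of_summable (summable_norm_neg_mul_pow a hq)

theorem qPochInf_ne_zero_of_forall {a q : ℂ} (hq : ‖q‖ < 1) (h : ∀ i : ℕ, 1 - a * q ^ i ≠ 0) :
    qPochInf a q ≠ 0 := by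
  have := tprod_one_add_ne_zero_of_summable (f := fun i : ℕ => -(a * q ^ i))
    (fun i => by simpa [sub_eq_add_neg] using h i) (summable_norm_neg_mul_pow a hq)
  simpa [qPochInf, sub_eq_add_neg] using this

theorem qPochInf_ne_zero {a q : ℂ} (ha : ‖a‖ < 1) (hq : ‖q‖ < 1) : qPochInf a q ≠ 0 :=
  qPochInf_ne_zero_of_forall hq (one_sub_mul_pow_ne_zero ha hq)

theorem qFactorial_ne_zero {q : ℂ} (hq : ‖q‖ < 1) (n : ℕ) : qFactorial q n ≠ 0 :=
  Finset.prod_ne_zero_iff.mpr fun i _ => by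
    simpa [pow_succ'] using one_sub_mul_pow_ne_zero hq hq i

theorem tendsto_qFactorial {q : ℂ} (hq : ‖q‖ < 1) :
    Tendsto (qFactorial q) atTop (𝓝 (qPochInf q q)) := by
  have : qFactorial q = fun n => ∏ i ∈ Finset.range n, (1 - q * q ^ i) := by
    funext n; simp only [qFactorial, pow_succ']
  rw [this]
  exact (multipliable_one_sub_mul_pow q hq).tendsto_prod_tprod_nat

/-- The extension by zero is consistent with this recursion because 1 - q^0 = 0; no boundary cases
arise later. -/
theorem invQFactorial_sub_one {q : ℂ} (hq : ‖q‖ < 1) (m : ℤ) :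
    invQFactorial q (m - 1) = (1 - q ^ m) * invQFactorial q m := by
  rcases lt_trichotomy m 0 with h | h | h
  · rw [invQFactorial, invQFactorial, if_neg (by omega), if_neg (by omega), mul_zero]
  · subst h; simp [invQFactorial]
  · obtain ⟨k, rfl⟩ : ∃ k : ℕ, m = (k : ℤ) + 1 := ⟨(m - 1).toNat, by omega⟩
    have h0 := qFactorial_ne_zero hq k
    have h1 := qFactorial_ne_zero hq (k + 1)
    have h2 : qFactorial q (k + 1) = qFactorial q k * (1 - q ^ (k + 1)) :=
      Finset.prod_range_succ _ _
    have e : q ^ ((k : ℤ) + 1) = q ^ (k + 1) := by exact_mod_cast zpow_natCast q (k + 1)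
    have e' : ((k : ℤ) + 1).toNat = k + 1 := by omega
    simp only [invQFactorial, add_sub_cancel_right, Int.natCast_nonneg, if_true, Int.toNat_natCast,
      show (0 : ℤ) ≤ (k : ℤ) + 1 by omega, e, e']
    field_simp
    exact h2

theorem tendsto_invQFactorial {q : ℂ} (hq : ‖q‖ < 1) :
    Tendsto (invQFactorial q) atTop (𝓝 (qPochInf q q)⁻¹) := by
  have h1 : Tendsto (fun m : ℤ => m.toNat) atTop atTop :=
    tendsto_atTop.mpr fun b => (eventually_ge_atTop (b : ℤ)).mono fun m hm => by omega
  have := ((tendsto_qFactorial hq).comp h1).inv₀ (qPochInf_ne_zero hq hq)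
  refine this.congr' ((eventually_ge_atTop 0).mono fun m hm => ?_)
  simp [invQFactorial, hm]

theorem exists_norm_invQFactorial_le {q : ℂ} (hq : ‖q‖ < 1) :
    ∃ K : ℝ, ∀ m, ‖invQFactorial q m‖ ≤ K := by
  obtain ⟨K, hK⟩ := ((tendsto_qFactorial hq).inv₀ (qPochInf_ne_zero hq hq)).norm.bddAbove_range
  refine ⟨max K 0, fun m => ?_⟩
  unfold invQFactorial
  split_ifs with h
  · exact (hK ⟨m.toNat, rfl⟩).trans (le_max_left _ _)
  · simp

theorem exists_norm_qFactorial_le {q : ℂ} (hq : ‖q‖ < 1) :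
    ∃ K : ℝ, ∀ n, ‖qFactorial q n‖ ≤ K := by
  obtain ⟨K, hK⟩ := (tendsto_qFactorial hq).norm.bddAbove_range
  exact ⟨K, fun n => hK ⟨n, rfl⟩⟩

/-! ### The finite triple product and its limit -/

/-- The ratio of the coefficients of the finite and the infinite triple product. -/
noncomputable def tripleRatio (q : ℂ) (N : ℕ) (n : ℤ) : ℂ :=
  qFactorial q (2 * N + 1) * invQFactorial q (N - n) * invQFactorial q (N + 1 + n)

theorem tendsto_tripleRatio {q : ℂ} (hq : ‖q‖ < 1) (n : ℤ) :
    Tendsto (fun N => tripleRatio q N n) atTop (𝓝 (qPochInf q q)⁻¹) := by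
  have h0 := qPochInf_ne_zero hq hq
  have hN : Tendsto (fun N : ℕ => (N : ℤ)) atTop atTop := tendsto_natCast_atTop_atTop
  have h1 : Tendsto (fun N : ℕ => 2 * N + 1) atTop atTop :=
    tendsto_atTop.mpr fun b => (eventually_ge_atTop b).mono fun m hm => by omega
  have h2 : Tendsto (fun N : ℕ => (N : ℤ) - n) atTop atTop :=
    tendsto_atTop_add_const_right _ (-n) hN
  have h3 : Tendsto (fun N : ℕ => (N : ℤ) + 1 + n) atTop atTop :=
    tendsto_atTop_add_const_right _ n (tendsto_atTop_add_const_right _ 1 hN)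
  have := (((tendsto_qFactorial hq).comp h1).mul ((tendsto_invQFactorial hq).comp h2)).mul
    ((tendsto_invQFactorial hq).comp h3)
  rwa [mul_inv_cancel₀ h0, one_mul] at this

theorem exists_norm_tripleRatio_le {q : ℂ} (hq : ‖q‖ < 1) :
    ∃ K : ℝ, ∀ N n, ‖tripleRatio q N n‖ ≤ K := by
  obtain ⟨A, hA⟩ := exists_norm_qFactorial_le hq
  obtain ⟨B, hB⟩ := exists_norm_invQFactorial_le hq
  have hA0 : 0 ≤ A := (norm_nonneg _).trans (hA 0)
  have hB0 : 0 ≤ B := (norm_nonneg _).trans (hB 0)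
  refine ⟨A * B * B, fun N n => ?_⟩
  rw [tripleRatio, norm_mul, norm_mul]
  gcongr
  exacts [hA _, hB _, hB _]

/-- The coefficients of the theta series `∑ (-1)^n p^(n(n+1)) zⁿ`. -/
noncomputable def thetaCoeff (p : ℂ) (n : ℤ) : ℂ := (-1) ^ n * p ^ (n * (n + 1))

theorem thetaCoeff_add_one {p : ℂ} (hp : p ≠ 0) (n : ℤ) :
    thetaCoeff p (n + 1) = -p ^ (2 * n + 2) * thetaCoeff p n := by
  rw [thetaCoeff, thetaCoeff, zpow_add_one₀ (by norm_num),
    show (n + 1) * (n + 1 + 1) = (2 * n + 2) + n * (n + 1) by ring, zpow_add₀ hp]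
  ring

theorem thetaCoeff_sub_one {p : ℂ} (hp : p ≠ 0) (n : ℤ) :
    thetaCoeff p (n - 1) = -p ^ (-2 * n) * thetaCoeff p n := by
  rw [thetaCoeff, thetaCoeff, zpow_sub_one₀ (by norm_num),
    show (n - 1) * (n - 1 + 1) = -2 * n + n * (n + 1) by ring, zpow_add₀ hp]
  norm_num
  ring

/-- This is multiplication by (1 - sz)(1 - s/z) = 1 + s² - s(z + 1/z), with s = q^(N+1), read off on
coefficients of z^n. -/
theorem thetaCoeff_mul_tripleRatio_succ {p : ℂ} (hp : p ≠ 0) (h1 : ‖p ^ 2‖ < 1) (N : ℕ) (n : ℤ) :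
    thetaCoeff p n * tripleRatio (p ^ 2) (N + 1) n =
      (1 + ((p ^ 2) ^ (N + 1)) ^ 2) * (thetaCoeff p n * tripleRatio (p ^ 2) N n) -
        (p ^ 2) ^ (N + 1) * (thetaCoeff p (n - 1) * tripleRatio (p ^ 2) N (n - 1) +
          thetaCoeff p (n + 1) * tripleRatio (p ^ 2) N (n + 1)) := by
  set q := p ^ 2 with hq
  have hq0 : q ≠ 0 := pow_ne_zero 2 hp
  -- All reciprocal factorials involved are polynomial multiples of `r₁` and `r₂`, so the claim
  -- becomes a rational identity in s, t and q.
  set r₁ := invQFactorial q (N + 1 - n) with hr₁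
  set r₂ := invQFactorial q (N + 2 + n) with hr₂
  set t := q ^ n with ht
  set s := q ^ (N + 1) with hs
  have ht0 : t ≠ 0 := zpow_ne_zero _ hq0
  have hs' : q ^ ((N : ℤ) + 1) = s := by exact_mod_cast zpow_natCast q (N + 1)
  have A1 := invQFactorial_sub_one h1 (N + 1 - n)
  have A2 := invQFactorial_sub_one h1 (N - n)
  have B1 := invQFactorial_sub_one h1 (N + 2 + n)
  have B2 := invQFactorial_sub_one h1 (N + 1 + n)
  have e1 : q ^ ((N : ℤ) + 1 - n) = s / t := by rw [zpow_sub₀ hq0, hs']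
  have e2 : q ^ ((N : ℤ) - n) = s / t / q := by
    rw [show (N : ℤ) - n = (N + 1 - n) - 1 by ring, zpow_sub_one₀ hq0, e1, ← div_eq_mul_inv]
  have e3 : q ^ ((N : ℤ) + 1 + n) = s * t := by rw [zpow_add₀ hq0, hs']
  have e4 : q ^ ((N : ℤ) + 2 + n) = s * t * q := by
    rw [show (N : ℤ) + 2 + n = (N + 1 + n) + 1 by ring, zpow_add_one₀ hq0, e3]
  rw [e1, show (N : ℤ) + 1 - n - 1 = N - n by ring] at A1
  rw [e2, A1] at A2
  rw [e4, show (N : ℤ) + 2 + n - 1 = N + 1 + n by ring] at B1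
  rw [e3, B1] at B2
  have f1 : p ^ (2 * n + 2) = t * q := by
    rw [zpow_add₀ hp, zpow_mul]; norm_cast
  have f2 : p ^ (-2 * n) = t⁻¹ := by
    rw [neg_mul, zpow_neg, zpow_mul]; norm_cast
  have hP : qFactorial q (2 * (N + 1) + 1) =
      qFactorial q (2 * N + 1) * (1 - s ^ 2) * (1 - s ^ 2 * q) := by
    rw [show 2 * (N + 1) + 1 = 2 * N + 1 + 1 + 1 by ring, qFactorial, Finset.prod_range_succ,
      Finset.prod_range_succ, ← qFactorial, hs]
    ring
  rw [thetaCoeff_add_one hp, thetaCoeff_sub_one hp, f1, f2]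
  simp only [tripleRatio, hP]
  push_cast
  rw [show (N : ℤ) + 1 + 1 + n = N + 2 + n by ring, show (N : ℤ) - (n - 1) = N + 1 - n by ring,
    show (N : ℤ) + 1 + (n - 1) = N + 1 + n - 1 by ring, show (N : ℤ) - (n + 1) = N - n - 1 by ring,
    show (N : ℤ) + 1 + (n + 1) = N + 2 + n by ring, A2, A1, B2, B1, ← hr₁, ← hr₂]
  field_simp
  ring

theorem tripleRatio_eq_zero (q : ℂ) {N : ℕ} {n : ℤ} (hn : n ∉ Finset.Icc (-(N : ℤ) - 1) N) :
    tripleRatio q N n = 0 := by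
  simp only [Finset.mem_Icc, not_and_or, not_le] at hn
  rcases hn with h | h
  · simp [tripleRatio, invQFactorial, show ¬ (0 ≤ (N : ℤ) + 1 + n) by omega]
  · simp [tripleRatio, invQFactorial, show ¬ (n ≤ N) by omega]

/-- Finite form of the triple product identity, for a sequence `χ` in place of `zⁿ`. -/
theorem hasSum_tripleRatio {p : ℂ} (hp : p ≠ 0) (h1 : ‖p ^ 2‖ < 1) {χ : ℤ → ℂ} {l : ℂ}
    (hχ : ∀ n, χ (n + 1) + χ (n - 1) = l * χ n) (N : ℕ) :
    HasSum (fun n => χ n * (thetaCoeff p n * tripleRatio (p ^ 2) N n))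
      ((χ 0 - χ (-1)) *
        ∏ i ∈ Finset.range N, (1 - l * (p ^ 2) ^ (i + 1) + ((p ^ 2) ^ (i + 1)) ^ 2)) := by
  induction N with
  | zero =>
    have hz : 1 - p ^ 2 ≠ 0 := by simpa [qFactorial] using qFactorial_ne_zero h1 1
    -- For N = 0 only two terms survive, with signs 1 and -1; they produce the factor `χ 0 - χ
    -- (-1)`.
    have : ∀ n ∉ ({0, -1} : Finset ℤ),
        χ n * (thetaCoeff p n * tripleRatio (p ^ 2) 0 n) = 0 := by
      intro n hn
      rw [tripleRatio_eq_zero, mul_zero, mul_zero]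
      simp only [Finset.mem_insert, Finset.mem_singleton, Finset.mem_Icc] at hn ⊢
      push_cast
      omega
    have h := hasSum_sum_of_ne_finset_zero (L := .unconditional ℤ) this
    convert h using 1
    simp [tripleRatio, invQFactorial, thetaCoeff, qFactorial, hz]
    ring
  | succ N ih =>
    set f := fun n => thetaCoeff p n * tripleRatio (p ^ 2) N n with hf
    have hfin (g : ℤ → ℂ) : Summable fun n => g n * f n := by
      refine summable_of_ne_finset_zero (s := Finset.Icc (-(N : ℤ) - 1) N) fun n hn => ?_
      simp only [hf, tripleRatio_eq_zero _ hn, mul_zero]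
    have h2 : HasSum (fun n => χ n * f (n - 1)) (∑' n, χ (n + 1) * f n) := by
      rw [← (Equiv.addRight (1 : ℤ)).hasSum_iff]
      simpa [Function.comp_def] using (hfin fun n => χ (n + 1)).hasSum
    have h3 : HasSum (fun n => χ n * f (n + 1)) (∑' n, χ (n - 1) * f n) := by
      rw [← (Equiv.subRight (1 : ℤ)).hasSum_iff]
      simpa [Function.comp_def] using (hfin fun n => χ (n - 1)).hasSum
    -- Moving the shifts from the coefficients onto `χ` lets its eigenvalue relation replace z + 1/z
    -- by `l`.
    have h4 : ∑' n, χ (n + 1) * f n + ∑' n, χ (n - 1) * f n = l * ∑' n, χ n * f n := by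
      rw [← (hfin fun n => χ (n + 1)).tsum_add (hfin fun n => χ (n - 1)), ← tsum_mul_left]
      refine tsum_congr fun n => ?_
      rw [← add_mul, hχ, mul_assoc]
    convert (ih.mul_left (1 + ((p ^ 2) ^ (N + 1)) ^ 2)).sub
      ((h2.add h3).mul_left ((p ^ 2) ^ (N + 1))) using 1
    · rfl
    · funext n
      rw [thetaCoeff_mul_tripleRatio_succ hp h1]
      simp only [hf]
      ring
    · rw [h4, ih.tsum_eq, Finset.prod_range_succ]
      ring

/-- The triple product identity, for a sequence `χ` in place of `zⁿ`. -/
theorem tsum_mul_thetaCoeff {p : ℂ} (hp : p ≠ 0) (h1 : ‖p ^ 2‖ < 1) {χ : ℤ → ℂ} {l P : ℂ}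
    (hχ : ∀ n, χ (n + 1) + χ (n - 1) = l * χ n) (hs : Summable fun n => ‖χ n * thetaCoeff p n‖)
    (hP : Tendsto (fun N => ∏ i ∈ Finset.range N,
      (1 - l * (p ^ 2) ^ (i + 1) + ((p ^ 2) ^ (i + 1)) ^ 2)) atTop (𝓝 P)) :
    ∑' n, χ n * thetaCoeff p n = qPochInf (p ^ 2) (p ^ 2) * ((χ 0 - χ (-1)) * P) := by
  obtain ⟨K, hK⟩ := exists_norm_tripleRatio_le h1
  -- The ratios are bounded uniformly in N and n, so the limit passes through the sum.
  have hlim := tendsto_tsum_of_dominated_convergence (𝓕 := atTop)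
    (f := fun N n => χ n * (thetaCoeff p n * tripleRatio (p ^ 2) N n))
    (g := fun n => χ n * thetaCoeff p n * (qPochInf (p ^ 2) (p ^ 2))⁻¹) (hs.mul_right K)
    (fun n => by
      simpa [mul_assoc] using (tendsto_tripleRatio h1 n).const_mul (χ n * thetaCoeff p n))
    (Eventually.of_forall fun N n => by
      rw [← mul_assoc, norm_mul]
      gcongr
      exact hK N n)
  simp only [(hasSum_tripleRatio hp h1 hχ _).tsum_eq, tsum_mul_right] at hlim
  have := tendsto_nhds_unique hlim (hP.const_mul (χ 0 - χ (-1)))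
  rw [← this]
  field_simp [qPochInf_ne_zero h1 h1]

/-! ### Summability of theta series with linear weights -/

theorem summable_pow_sq_mul_pow {r : ℝ} (h0 : 0 ≤ r) (h1 : r < 1) {x : ℝ} (hx : 0 ≤ x) :
    Summable fun n : ℕ => r ^ (n * n) * x ^ n := by
  have h2 : Tendsto (fun n : ℕ => r ^ n * x) atTop (𝓝 0) := by
    simpa using (tendsto_pow_atTop_nhds_zero_of_lt_one h0 h1).mul_const x
  refine Summable.of_norm_bounded_eventually_nat (g := fun n => (1 / 2 : ℝ) ^ n)
    (summable_geometric_of_lt_one (by norm_num) (by norm_num)) ?_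
  filter_upwards [h2.eventually (ge_mem_nhds (show (0 : ℝ) < 1 / 2 by norm_num))] with n hn
  rw [pow_mul, ← mul_pow, Real.norm_of_nonneg (by positivity)]
  exact pow_le_pow_left₀ (by positivity) hn n

theorem summable_zpow_sq_mul_zpow {r : ℝ} (h0 : 0 ≤ r) (h1 : r < 1) {x : ℝ} (hx : 0 ≤ x) :
    Summable fun n : ℤ => r ^ (n * n) * x ^ n := by
  refine Summable.of_nat_of_neg ?_ ?_
  · simpa [← Nat.cast_mul, -Nat.cast_mul] using
      (show Summable fun n : ℕ => r ^ ((n * n : ℕ) : ℤ) * x ^ (n : ℤ) by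
        simpa only [zpow_natCast] using summable_pow_sq_mul_pow h0 h1 hx)
  · have := summable_pow_sq_mul_pow h0 h1 (inv_nonneg.mpr hx)
    refine this.congr fun n => ?_
    rw [neg_mul_neg, zpow_neg, ← inv_zpow, ← Nat.cast_mul, zpow_natCast, zpow_natCast]

/-- Absorbs a linear weight into the geometric factor, replacing z by 2z and z/2. -/
theorem abs_intCast_le_two_zpow_add (n : ℤ) : |(n : ℝ)| ≤ (2 : ℝ) ^ n + 2⁻¹ ^ n := by
  have key (k : ℕ) : (k : ℝ) ≤ 2 ^ k := by exact_mod_cast k.lt_two_pow_self.le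
  rcases Int.eq_nat_or_neg n with ⟨k, rfl | rfl⟩
  · have : (0 : ℝ) < 2⁻¹ ^ (k : ℤ) := by positivity
    simp only [Int.cast_natCast, Nat.abs_cast, zpow_natCast] at *
    linarith [key k]
  · have : (0 : ℝ) < 2 ^ (-(k : ℤ)) := by positivity
    simp only [Int.cast_neg, Int.cast_natCast, abs_neg, Nat.abs_cast, inv_zpow', neg_neg,
      zpow_natCast] at *
    linarith [key k]

/-- A quadratic exponential sequence times a linear one is summable over `ℤ`. -/
theorem summable_linear_mul_zpow_sq {p : ℂ} (h1 : ‖p‖ < 1) (z a b : ℂ) :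
    Summable fun n : ℤ => ‖(a * n + b) * (p ^ (n * n) * z ^ n)‖ := by
  have hb := summable_zpow_sq_mul_zpow (norm_nonneg p) h1 (norm_nonneg z)
  have h2 := summable_zpow_sq_mul_zpow (norm_nonneg p) h1 (show 0 ≤ 2 * ‖z‖ by positivity)
  have h3 := summable_zpow_sq_mul_zpow (norm_nonneg p) h1 (show 0 ≤ 2⁻¹ * ‖z‖ by positivity)
  refine Summable.of_nonneg_of_le (fun _ => norm_nonneg _) (fun n => ?_)
    (((h2.add h3).mul_left ‖a‖).add (hb.mul_left ‖b‖))
  rw [norm_mul, norm_mul, norm_zpow, norm_zpow, mul_zpow, mul_zpow]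
  calc _ ≤ (‖a‖ * ((2 : ℝ) ^ n + 2⁻¹ ^ n) + ‖b‖) * (‖p‖ ^ (n * n) * ‖z‖ ^ n) := by
        gcongr
        refine (norm_add_le _ _).trans ?_
        rw [norm_mul, Complex.norm_intCast]
        gcongr
        exact abs_intCast_le_two_zpow_add n
    _ = _ := by ring

theorem thetaCoeff_eq {p : ℂ} (hp : p ≠ 0) (n : ℤ) : thetaCoeff p n = p ^ (n * n) * (-p) ^ n := by
  rw [thetaCoeff, neg_eq_neg_one_mul p, mul_zpow, mul_add, mul_one, zpow_add₀ hp]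
  ring

theorem summable_linear_mul_zpow_mul_thetaCoeff {p : ℂ} (hp : p ≠ 0) (h1 : ‖p‖ < 1) (z a b : ℂ) :
    Summable fun n : ℤ => ‖(a * n + b) * (z ^ n * thetaCoeff p n)‖ := by
  refine (summable_linear_mul_zpow_sq h1 (z * -p) a b).congr fun n => ?_
  rw [thetaCoeff_eq hp, mul_zpow]
  ring_nf

theorem summable_zpow_mul_thetaCoeff {p : ℂ} (hp : p ≠ 0) (h1 : ‖p‖ < 1) (z : ℂ) :
    Summable fun n : ℤ => ‖z ^ n * thetaCoeff p n‖ := by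
  simpa using summable_linear_mul_zpow_mul_thetaCoeff hp h1 z 0 1

/-! ### Jacobi's triple product and cube identities -/

theorem norm_sq_lt_one {p : ℂ} (h1 : ‖p‖ < 1) : ‖p ^ 2‖ < 1 := by
  rw [norm_pow]; exact pow_lt_one₀ (norm_nonneg _) h1 (by norm_num)

theorem qPochInf_eq_one_sub_mul (a : ℂ) {q : ℂ} (hq : ‖q‖ < 1) :
    qPochInf a q = (1 - a) * qPochInf (a * q) q := by
  have h := multipliable_one_sub_mul_pow (a * q) hq
  have e (i : ℕ) : 1 - a * q * q ^ i = 1 - a * q ^ (i + 1) := by ring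
  simp only [e] at h
  have := tprod_eq_zero_mul' (f := fun i : ℕ => 1 - a * q ^ i) h
  simpa only [qPochInf, e, pow_zero, mul_one] using this

/-- **Jacobi triple product identity**. -/
theorem tsum_zpow_mul_thetaCoeff {p : ℂ} (hp : p ≠ 0) (h1 : ‖p‖ < 1) {z : ℂ} (hz : z ≠ 0) :
    ∑' n : ℤ, z ^ n * thetaCoeff p n =
      qPochInf (p ^ 2) (p ^ 2) * qPochInf z⁻¹ (p ^ 2) * qPochInf (p ^ 2 * z) (p ^ 2) := by
  have h2 := norm_sq_lt_one h1
  have hP := (multipliable_one_sub_mul_pow (p ^ 2 * z) h2).tendsto_prod_tprod_nat.mul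
    (multipliable_one_sub_mul_pow (z⁻¹ * p ^ 2) h2).tendsto_prod_tprod_nat
  -- Here `χ 0 - χ (-1)` is 1 - z⁻¹, the missing initial factor of (z⁻¹; p²)_∞.
  rw [tsum_mul_thetaCoeff (l := z + z⁻¹) hp h2
    (fun n => by rw [zpow_add_one₀ hz, zpow_sub_one₀ hz]; ring)
    (summable_zpow_mul_thetaCoeff hp h1 z) (hP.congr fun N => ?_),
    qPochInf_eq_one_sub_mul z⁻¹ h2]
  · simp only [qPochInf, zpow_zero, zpow_neg_one]
    ring
  · rw [← Finset.prod_mul_distrib]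
    refine Finset.prod_congr rfl fun i _ => ?_
    field_simp
    ring

/-- **Jacobi's identity** for the cube of the Euler function. -/
theorem tsum_two_mul_add_one_mul_thetaCoeff {p : ℂ} (hp : p ≠ 0) (h1 : ‖p‖ < 1) :
    ∑' n : ℤ, (2 * n + 1) * thetaCoeff p n = 2 * qPochInf (p ^ 2) (p ^ 2) ^ 3 := by
  have h2 := norm_sq_lt_one h1
  have hP := (multipliable_one_sub_mul_pow (p ^ 2) h2).tendsto_prod_tprod_nat
  have := tsum_mul_thetaCoeff (χ := fun n => 2 * n + 1) (l := 2) hp h2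
    (fun n => by push_cast; ring)
    (by simpa using summable_linear_mul_zpow_mul_thetaCoeff hp h1 1 2 1)
    ((hP.mul hP).congr fun N => ?_)
  · rw [this, qPochInf]
    push_cast
    ring
  · rw [← Finset.prod_mul_distrib]
    refine Finset.prod_congr rfl fun i _ => ?_
    ring

theorem tsum_thetaCoeff {p : ℂ} (hp : p ≠ 0) (h1 : ‖p‖ < 1) : ∑' n : ℤ, thetaCoeff p n = 0 := by
  have h2 := norm_sq_lt_one h1
  have := tsum_zpow_mul_thetaCoeff hp h1 one_ne_zero
  have h0 : qPochInf 1 (p ^ 2) = 0 := by rw [qPochInf_eq_one_sub_mul _ h2]; simp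
  simpa [h0] using this

/-! ### Splitting products and bilateral series by residues -/

/-- Decomposition of `(a; q)_∞` into factors with nome `q ^ k`. -/
theorem qPochInf_eq_prod (a : ℂ) {q : ℂ} (hq : ‖q‖ < 1) (k : ℕ) [NeZero k] :
    qPochInf a q = ∏ r : Fin k, qPochInf (a * q ^ (r : ℕ)) (q ^ k) := by
  have hqk : ‖q ^ k‖ < 1 := by
    rw [norm_pow]; exact pow_lt_one₀ (norm_nonneg _) hq (NeZero.ne k)
  have h := (multipliable_one_sub_mul_pow a hq).hasProd
  rw [← ((Equiv.prodComm (Fin k) ℕ).trans (Nat.divModEquiv k).symm).hasProd_iff] at h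
  refine (h.prod_fiberwise (g := fun r : Fin k => qPochInf (a * q ^ (r : ℕ)) (q ^ k))
    fun r => ?_).unique (hasProd_fintype _)
  convert (multipliable_one_sub_mul_pow (a * q ^ (r : ℕ)) hqk).hasProd using 2 with i
  · simp [Nat.divModEquiv, pow_add, pow_mul, mul_comm, mul_assoc]
  · rfl

theorem qPochInf_mul_qPochInf_neg (a : ℂ) {q : ℂ} (hq : ‖q‖ < 1) :
    qPochInf a q * qPochInf (-a) q = qPochInf (a ^ 2) (q ^ 2) := by
  rw [qPochInf, qPochInf, ← (multipliable_one_sub_mul_pow a hq).tprod_mul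
    (multipliable_one_sub_mul_pow (-a) hq), qPochInf]
  refine tprod_congr fun i => ?_
  ring

/-- Splitting a bilateral series by residue classes. -/
theorem tsum_int_eq_sum_residue {f : ℤ → ℂ} (hf : Summable f) (k : ℕ) [NeZero k] :
    ∑' n, f n = ∑ r : Fin k, ∑' j : ℤ, f (j * k + r) := by
  have h := hf.hasSum
  rw [← ((Equiv.prodComm (Fin k) ℤ).trans (Int.divModEquiv k).symm).hasSum_iff] at h
  refine (h.prod_fiberwise (g := fun r : Fin k => ∑' j : ℤ, f (j * k + r))
    fun r => ?_).unique (hasSum_fintype _)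
  exact (h.summable.prod_factor r).hasSum

/-- The shear `(N, n) ↦ (N - k n, n)` of `ℤ × ℤ`. -/
def intShear (k : ℤ) : ℤ × ℤ ≃ ℤ × ℤ where
  toFun x := (x.1 - k * x.2, x.2)
  invFun x := (x.1 + k * x.2, x.2)
  left_inv x := by simp
  right_inv x := by simp

theorem pow_zpow_eq (q : ℂ) (k : ℕ) (t : ℤ) : (q ^ k) ^ t = q ^ ((k : ℤ) * t) := by
  rw [zpow_mul, zpow_natCast]

theorem neg_one_zpow_neg (n : ℤ) : (-1 : ℂ) ^ (-n) = (-1) ^ n := by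
  rw [zpow_neg, ← inv_zpow]; norm_num

theorem norm_pow_lt_one_of_ne_zero {q : ℂ} (h1 : ‖q‖ < 1) {k : ℕ} (hk : k ≠ 0) : ‖q ^ k‖ < 1 := by
  rw [norm_pow]; exact pow_lt_one₀ (norm_nonneg _) h1 hk

/-! ### Theta series for the first identity -/

theorem summable_linear_mul_sq {q : ℂ} (h1 : ‖q‖ < 1) (a b : ℂ) :
    Summable fun m : ℤ => ‖(a * m + b) * q ^ (m * m)‖ := by
  simpa using summable_linear_mul_zpow_sq h1 1 a b

theorem tsum_intCast_mul_sq (q : ℂ) : ∑' m : ℤ, (m : ℂ) * q ^ (m * m) = 0 := by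
  have h := (Equiv.neg ℤ).tsum_eq fun m : ℤ => (m : ℂ) * q ^ (m * m)
  simp only [Equiv.neg_apply, Int.cast_neg, neg_mul_neg] at h
  simp only [neg_mul, tsum_neg] at h
  exact self_eq_neg.mp h.symm

theorem tsum_sq {q : ℂ} (hq : q ≠ 0) (h1 : ‖q‖ < 1) :
    ∑' m : ℤ, q ^ (m * m) = qPochInf (q ^ 2) (q ^ 2) * qPochInf (-q) (q ^ 2) ^ 2 := by
  -- This z cancels the linear part of the exponent and the sign, and makes the two z-dependent
  -- products equal.
  have h := tsum_zpow_mul_thetaCoeff hq h1 (z := (-q)⁻¹) (by simpa)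
  have e : q ^ 2 * (-q)⁻¹ = -q := by field_simp
  rw [e, inv_inv] at h
  rw [pow_two (qPochInf (-q) (q ^ 2)), ← mul_assoc, ← h]
  refine tsum_congr fun m => ?_
  rw [thetaCoeff_eq hq, inv_zpow, mul_left_comm, inv_mul_cancel₀ (zpow_ne_zero _ (by simpa)),
    mul_one]

theorem neg_one_zpow_mul_zpow_eq {q : ℂ} (hq : q ≠ 0) (n : ℤ) :
    (-1) ^ n * q ^ (6 * n * n + 2 * n) = (q ^ 4)⁻¹ ^ n * thetaCoeff (q ^ 6) n := by
  rw [thetaCoeff, inv_zpow, ← zpow_neg, pow_zpow_eq, pow_zpow_eq, mul_left_comm, ← zpow_add₀ hq]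
  congr 2
  push_cast
  ring

/-- Euler's pentagonal number theorem, at `q ^ 4`. -/
theorem tsum_pentagonal {q : ℂ} (hq : q ≠ 0) (h1 : ‖q‖ < 1) :
    ∑' n : ℤ, (-1) ^ n * q ^ (6 * n * n + 2 * n) = qPochInf (q ^ 4) (q ^ 4) := by
  simp only [neg_one_zpow_mul_zpow_eq hq]
  rw [tsum_zpow_mul_thetaCoeff (pow_ne_zero 6 hq) (norm_pow_lt_one_of_ne_zero h1 (by norm_num))
    (inv_ne_zero (pow_ne_zero 4 hq)),
    qPochInf_eq_prod (q ^ 4) (norm_pow_lt_one_of_ne_zero h1 (by norm_num)) 3, Fin.prod_univ_three,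
    show (q ^ 6) ^ 2 * (q ^ 4)⁻¹ = q ^ 8 by field_simp]
  simp only [inv_inv, Fin.val_zero, Fin.val_one, Fin.val_two]
  ring_nf

theorem sq_mul_thetaCoeff_eq {q : ℂ} (hq : q ≠ 0) (m n : ℤ) :
    q ^ (m * m) * thetaCoeff (q ^ 2) n = (-1) ^ n * q ^ (m * m + 2 * (n * (n + 1))) := by
  rw [thetaCoeff, pow_zpow_eq, mul_left_comm, ← zpow_add₀ hq]
  rfl

theorem neg_one_zpow_add (m n : ℤ) : (-1 : ℂ) ^ (m + n) = (-1) ^ m * (-1) ^ n :=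
  zpow_add₀ (by norm_num) _ _

/-- Coefficients of the product of the two theta series, in the residue class `0` modulo `3`. -/
theorem tsum_convolution_zero {q : ℂ} (hq : q ≠ 0) (h1 : ‖q‖ < 1) (k : ℤ) :
    ∑' n : ℤ, q ^ ((3 * k - 2 * n) * (3 * k - 2 * n)) * thetaCoeff (q ^ 2) n =
      (-1) ^ k * q ^ (3 * k * k + 2 * k) * qPochInf (q ^ 4) (q ^ 4) := by
  rw [← tsum_pentagonal hq h1, ← tsum_mul_left, ← (Equiv.addLeft k).tsum_eq]
  refine tsum_congr fun j => ?_
  rw [Equiv.coe_addLeft, sq_mul_thetaCoeff_eq hq, neg_one_zpow_add, mul_mul_mul_comm,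
    ← zpow_add₀ hq]
  ring_nf

/-- The substitution n = k - j (instead of k + j) completes the square with the pentagonal exponent
6j² + 2j. -/
theorem tsum_convolution_one {q : ℂ} (hq : q ≠ 0) (h1 : ‖q‖ < 1) (k : ℤ) :
    ∑' n : ℤ, q ^ ((3 * k + 1 - 2 * n) * (3 * k + 1 - 2 * n)) * thetaCoeff (q ^ 2) n =
      (-1) ^ k * q ^ (3 * k * k + 4 * k + 1) * qPochInf (q ^ 4) (q ^ 4) := by
  rw [← tsum_pentagonal hq h1, ← tsum_mul_left, ← (Equiv.subLeft k).tsum_eq]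
  refine tsum_congr fun j => ?_
  rw [Equiv.subLeft_apply, sq_mul_thetaCoeff_eq hq, sub_eq_add_neg, neg_one_zpow_add,
    neg_one_zpow_neg, mul_mul_mul_comm, ← zpow_add₀ hq]
  ring_nf

/-- With n = k + 1 + j the exponent is 6j(j+1) plus a constant, and the terms j and -1-j cancel. -/
theorem tsum_convolution_two {q : ℂ} (hq : q ≠ 0) (h1 : ‖q‖ < 1) (k : ℤ) :
    ∑' n : ℤ, q ^ ((3 * k + 2 - 2 * n) * (3 * k + 2 - 2 * n)) * thetaCoeff (q ^ 2) n = 0 := by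
  have h6 := norm_pow_lt_one_of_ne_zero h1 (show 6 ≠ 0 by norm_num)
  rw [← mul_zero ((-1) ^ (k + 1) * q ^ (3 * k * k + 6 * k + 4)),
    ← tsum_thetaCoeff (pow_ne_zero 6 hq) h6, ← tsum_mul_left, ← (Equiv.addLeft (k + 1)).tsum_eq]
  refine tsum_congr fun j => ?_
  rw [Equiv.coe_addLeft, sq_mul_thetaCoeff_eq hq, thetaCoeff, pow_zpow_eq, neg_one_zpow_add,
    mul_mul_mul_comm, ← zpow_add₀ hq]
  push_cast
  ring_nf

theorem summable_linear_mul_neg_one_zpow {q : ℂ} (hq : q ≠ 0) (h1 : ‖q‖ < 1) :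
    Summable fun k : ℤ => (3 * k + 1 : ℂ) * ((-1) ^ k * q ^ (3 * k * k + 2 * k)) := by
  refine Summable.of_norm ((summable_linear_mul_zpow_sq
    (norm_pow_lt_one_of_ne_zero h1 (show 3 ≠ 0 by norm_num)) (-q ^ 2) 3 1).congr fun k => ?_)
  rw [neg_eq_neg_one_mul (q ^ 2), mul_zpow, pow_zpow_eq, pow_zpow_eq, mul_left_comm (q ^ _),
    ← zpow_add₀ hq, Nat.cast_ofNat, Nat.cast_ofNat, mul_assoc (3 : ℤ)]

theorem summable_convolution_factor {u v : ℤ → ℂ} (k : ℤ) (hu : Summable fun n => ‖u n‖)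
    (hv : Summable fun n => ‖v n‖) (N : ℤ) : Summable fun n => u (N - k * n) * v n :=
  (((intShear k).summable_iff.mpr (summable_mul_of_summable_norm hu hv)).prod_factor N :)

/-- The absolutely convergent double sum over (m, n) is regrouped by N = m + kn. -/
theorem hasSum_convolution {u v : ℤ → ℂ} (k : ℤ) (hu : Summable fun n => ‖u n‖)
    (hv : Summable fun n => ‖v n‖) :
    HasSum (fun N => ∑' n, u (N - k * n) * v n) ((∑' n, u n) * ∑' n, v n) := by
  have H := hu.of_norm.hasSum.mul hv.of_norm.hasSum (summable_mul_of_summable_norm hu hv)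
  rw [← (intShear k).hasSum_iff] at H
  exact H.prod_fiberwise fun N => (summable_convolution_factor k hu hv N).hasSum

/-- Leibniz rule: the weight splits as N = (N - kn) + kn. -/
theorem hasSum_mul_convolution {u v : ℤ → ℂ} (k : ℤ) (hu : Summable fun n => ‖u n‖)
    (hu' : Summable fun n : ℤ => ‖(n : ℂ) * u n‖) (hv : Summable fun n => ‖v n‖)
    (hv' : Summable fun n : ℤ => ‖(n : ℂ) * v n‖) :
    HasSum (fun N : ℤ => (N : ℂ) * ∑' n, u (N - k * n) * v n)
      ((∑' n : ℤ, (n : ℂ) * u n) * (∑' n, v n) + k * ((∑' n, u n) * ∑' n : ℤ, (n : ℂ) * v n)) := by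
  have H := (hasSum_convolution k hu' hv).add ((hasSum_convolution k hu hv').mul_left (k : ℂ))
  convert H using 2 with N
  rw [← tsum_mul_left, ← tsum_mul_left, ← (summable_convolution_factor k hu' hv N).tsum_add
    ((summable_convolution_factor k hu hv' N).mul_left _)]
  refine tsum_congr fun n => ?_
  push_cast
  ring

theorem hasSum_theta_convolution {q : ℂ} (hq : q ≠ 0) (h1 : ‖q‖ < 1) :
    HasSum (fun N : ℤ => (N + 1 : ℂ) *
        ∑' n : ℤ, q ^ ((N - 2 * n) * (N - 2 * n)) * thetaCoeff (q ^ 2) n)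
      ((∑' m : ℤ, q ^ (m * m)) * ∑' n : ℤ, (2 * n + 1) * thetaCoeff (q ^ 2) n) := by
  have h2 := norm_sq_lt_one h1
  have hq2 : q ^ 2 ≠ 0 := pow_ne_zero 2 hq
  have s1 : Summable fun m : ℤ => ‖(m : ℂ) * q ^ (m * m)‖ := by
    simpa using summable_linear_mul_sq h1 1 0
  have s2 : Summable fun m : ℤ => ‖q ^ (m * m)‖ := by
    simpa using summable_linear_mul_sq h1 0 1
  have s3 : Summable fun n : ℤ => ‖thetaCoeff (q ^ 2) n‖ := by
    simpa using summable_linear_mul_zpow_mul_thetaCoeff hq2 h2 1 0 1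
  have s4 : Summable fun n : ℤ => ‖(n : ℂ) * thetaCoeff (q ^ 2) n‖ := by
    simpa using summable_linear_mul_zpow_mul_thetaCoeff hq2 h2 1 1 0
  have H := (hasSum_mul_convolution 2 s2 s1 s3 s4).add (hasSum_convolution 2 s2 s3)
  have e : ∑' n : ℤ, (2 * n + 1) * thetaCoeff (q ^ 2) n =
      2 * (∑' n : ℤ, (n : ℂ) * thetaCoeff (q ^ 2) n) + ∑' n : ℤ, thetaCoeff (q ^ 2) n := by
    rw [← tsum_mul_left, ← (s4.of_norm.mul_left 2).tsum_add s3.of_norm]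
    exact tsum_congr fun n => by ring
  rw [tsum_intCast_mul_sq, zero_mul, zero_add] at H
  rw [e]
  convert H using 1
  · exact funext fun N => by ring
  · push_cast
    ring

theorem tsum_convolution_residue_zero {q : ℂ} (hq : q ≠ 0) (h1 : ‖q‖ < 1) :
    ∑' k : ℤ, (((3 * k : ℤ) : ℂ) + 1) *
      ∑' n : ℤ, q ^ ((3 * k - 2 * n) * (3 * k - 2 * n)) * thetaCoeff (q ^ 2) n =
      (∑' k : ℤ, (3 * k + 1 : ℂ) * ((-1) ^ k * q ^ (3 * k * k + 2 * k))) *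
        qPochInf (q ^ 4) (q ^ 4) := by
  rw [← tsum_mul_right]
  refine tsum_congr fun k => ?_
  rw [tsum_convolution_zero hq h1]
  push_cast
  ring

theorem tsum_convolution_residue_one {q : ℂ} (hq : q ≠ 0) (h1 : ‖q‖ < 1) :
    ∑' k : ℤ, (((3 * k + 1 : ℤ) : ℂ) + 1) *
      ∑' n : ℤ, q ^ ((3 * k + 1 - 2 * n) * (3 * k + 1 - 2 * n)) * thetaCoeff (q ^ 2) n =
      (∑' k : ℤ, (3 * k + 1 : ℂ) * ((-1) ^ k * q ^ (3 * k * k + 2 * k))) *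
        qPochInf (q ^ 4) (q ^ 4) := by
  rw [← tsum_mul_right, ← (Equiv.subLeft (-1 : ℤ)).tsum_eq]
  refine tsum_congr fun k => ?_
  -- The reflection k ↦ -1-k negates both the sign and the weight 3k+2 ↦ -(3k+1), so this class
  -- equals the class 0.
  rw [Equiv.subLeft_apply, tsum_convolution_one hq h1, sub_eq_add_neg, neg_one_zpow_add,
    neg_one_zpow_neg k, show 3 * (-1 + -k) * (-1 + -k) + 4 * (-1 + -k) + 1 = 3 * k * k + 2 * k by ring]
  push_cast
  norm_num
  ring

theorem tsum_sq_mul_tsum_thetaCoeff {q : ℂ} (hq : q ≠ 0) (h1 : ‖q‖ < 1) :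
    (∑' m : ℤ, q ^ (m * m)) * ∑' n : ℤ, (2 * n + 1) * thetaCoeff (q ^ 2) n =
      2 * (∑' k : ℤ, (3 * k + 1 : ℂ) * ((-1) ^ k * q ^ (3 * k * k + 2 * k))) *
        qPochInf (q ^ 4) (q ^ 4) := by
  have H := hasSum_theta_convolution hq h1
  have K := tsum_int_eq_sum_residue H.summable 3
  rw [H.tsum_eq, Fin.sum_univ_three] at K
  simp only [Fin.val_zero, Fin.val_one, Fin.val_two, Nat.cast_ofNat, Nat.cast_zero, Nat.cast_one,
    add_zero, mul_comm _ (3 : ℤ), tsum_convolution_residue_zero hq h1,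
    tsum_convolution_residue_one hq h1, tsum_convolution_two hq h1, mul_zero, tsum_zero] at K
  rw [K]
  ring

theorem tsum_linear_mul_neg_one_zpow {q : ℂ} (hq : q ≠ 0) (h1 : ‖q‖ < 1) :
    ∑' k : ℤ, (3 * k + 1 : ℂ) * ((-1) ^ k * q ^ (3 * k * k + 2 * k)) =
      qPochInf (q ^ 2) (q ^ 2) ^ 5 / qPochInf q q ^ 2 := by
  have h2 := norm_pow_lt_one_of_ne_zero h1 (show 2 ≠ 0 by norm_num)
  have h4 := norm_pow_lt_one_of_ne_zero h1 (show 4 ≠ 0 by norm_num)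
  have n1 := qPochInf_ne_zero h1 h1
  have n4 := qPochInf_ne_zero h4 h4
  have K := tsum_sq_mul_tsum_thetaCoeff hq h1
  rw [tsum_sq hq h1, tsum_two_mul_add_one_mul_thetaCoeff (pow_ne_zero 2 hq) h2] at K
  have P1 := qPochInf_eq_prod q h1 2
  have P2 := qPochInf_eq_prod (q ^ 2) h2 2
  have P3 := qPochInf_mul_qPochInf_neg q h2
  simp only [Fin.prod_univ_two, Fin.val_zero, Fin.val_one, pow_zero, mul_one, pow_one, ← pow_two,
    ← pow_mul, Nat.reduceMul, ← pow_add, Nat.reduceAdd] at P1 P2 P3 K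
  have m1 : qPochInf q (q ^ 2) ≠ 0 := left_ne_zero_of_mul (P1 ▸ n1)
  have m2 : qPochInf (q ^ 2) (q ^ 2) ≠ 0 := right_ne_zero_of_mul (P1 ▸ n1)
  rw [eq_div_iff (pow_ne_zero 2 n1)]
  -- Eliminates (-q; q²)_∞ through (q; q²)_∞ (-q; q²)_∞ = (q²; q⁴)_∞.
  have P4 : qPochInf (-q) (q ^ 2) * qPochInf q q * qPochInf (q ^ 4) (q ^ 4) =
      qPochInf (q ^ 2) (q ^ 2) ^ 2 := by
    rw [P1]
    linear_combination (qPochInf (q ^ 2) (q ^ 2) * qPochInf (q ^ 4) (q ^ 4)) * P3 -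
      qPochInf (q ^ 2) (q ^ 2) * P2
  generalize (∑' k : ℤ, (3 * k + 1 : ℂ) * ((-1) ^ k * q ^ (3 * k * k + 2 * k))) = S at *
  generalize qPochInf (q ^ 2) (q ^ 2) = E₂ at *
  generalize qPochInf (q ^ 4) (q ^ 4) = E₄ at *
  generalize qPochInf (-q) (q ^ 2) = x at *
  have K' : S = E₂ * x ^ 2 * E₄ ^ 2 := by
    apply mul_right_cancel₀ n4
    linear_combination -K / 2
  rw [K', show E₂ ^ 5 = E₂ * (E₂ ^ 2) ^ 2 by ring, ← P4]
  ring

/-! ### Eta quotients, the Legendre symbol and the first identity -/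

theorem eta_natCast_mul (k : ℕ) (z : ℂ) :
    ModularForm.eta (k * z) = Complex.exp (2 * Real.pi * Complex.I * (k * z) / 24) *
      qPochInf (Complex.exp (2 * Real.pi * Complex.I * z) ^ k)
        (Complex.exp (2 * Real.pi * Complex.I * z) ^ k) := by
  have e (n : ℕ) : ModularForm.eta_q n (k * z) =
      Complex.exp (2 * Real.pi * Complex.I * z) ^ k *
        (Complex.exp (2 * Real.pi * Complex.I * z) ^ k) ^ n := by
    rw [ModularForm.eta_q_eq_pow, ← pow_succ', ← Complex.exp_nat_mul, ← Complex.exp_nat_mul,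
      ← Complex.exp_nat_mul]
    push_cast
    ring_nf
  simp only [ModularForm.eta, e, qPochInf, Function.Periodic.qParam]
  norm_num

theorem legendreSym_three_mul_add_one (k : ℤ) : legendreSym 3 (3 * k + 1) = 1 := by
  rw [legendreSym.mod, show (3 * k + 1) % ((3 : ℕ) : ℤ) = 1 by omega]
  decide

theorem legendreSym_three_mul_add_two (k : ℤ) : legendreSym 3 (3 * k + 2) = -1 := by
  rw [legendreSym.mod, show (3 * k + 2) % ((3 : ℕ) : ℤ) = 2 by omega]
  decide

theorem legendreSym_three_mul (k : ℤ) : legendreSym 3 (3 * k) = 0 := by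
  rw [legendreSym.mod, show (3 * k) % ((3 : ℕ) : ℤ) = 0 by omega]
  decide

/-- The map `k ↦ |3k + 1|`, a bijection from `ℤ` to the positive integers prime to `3`. -/
def absThreeMulAddOne (k : ℤ) : ℕ+ := ⟨(3 * k + 1).natAbs, by omega⟩

theorem absThreeMulAddOne_injective : Function.Injective absThreeMulAddOne := fun a b h => by
  have : (3 * a + 1).natAbs = (3 * b + 1).natAbs := congrArg PNat.val h
  omega

theorem eq_three_mul_of_notMem_range {n : ℕ+} (hn : n ∉ Set.range absThreeMulAddOne) :
    ∃ k : ℤ, ((n : ℕ) : ℤ) = 3 * k := by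
  by_contra! h
  have h1 := h ((n : ℤ) / 3)
  rcases (show (n : ℤ) % 3 = 1 ∨ (n : ℤ) % 3 = 2 by omega) with h2 | h2
  · refine hn ⟨(n : ℤ) / 3, PNat.eq ?_⟩
    change (3 * ((n : ℤ) / 3) + 1).natAbs = (n : ℕ)
    omega
  · refine hn ⟨-((n : ℤ) / 3) - 1, PNat.eq ?_⟩
    change (3 * (-((n : ℤ) / 3) - 1) + 1).natAbs = (n : ℕ)
    omega

/-- For k < 0 the absolute value reverses the sign of 3k+1, and the Legendre symbol -1 restores it.
-/
theorem neg_one_pow_mul_legendreSym_absThreeMulAddOne (k : ℤ) :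
    (-1 : ℂ) ^ ((absThreeMulAddOne k : ℕ) - 1) * ((absThreeMulAddOne k : ℕ) : ℂ) *
      ((legendreSym 3 ((absThreeMulAddOne k : ℕ) : ℤ) : ℤ) : ℂ) = (-1) ^ k * (3 * k + 1) := by
  rcases lt_or_ge k 0 with hk | hk
  · obtain ⟨j, rfl⟩ : ∃ j : ℕ, k = -((j : ℤ) + 1) := ⟨(-k - 1).toNat, by omega⟩
    have e : (absThreeMulAddOne (-((j : ℤ) + 1)) : ℕ) = 3 * j + 2 := by
      change (3 * (-((j : ℤ) + 1)) + 1).natAbs = _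
      omega
    rw [e, show ((3 * j + 2 : ℕ) : ℤ) = 3 * (j : ℤ) + 2 by push_cast; ring,
      legendreSym_three_mul_add_two, neg_one_zpow_neg, show 3 * j + 2 - 1 = 2 * j + j + 1 by omega,
      zpow_add_one₀ (by norm_num), zpow_natCast, pow_succ, pow_add, pow_mul]
    push_cast
    ring
  · obtain ⟨j, rfl⟩ : ∃ j : ℕ, k = j := ⟨k.toNat, by omega⟩
    have e : (absThreeMulAddOne (j : ℤ) : ℕ) = 3 * j + 1 := by
      change (3 * (j : ℤ) + 1).natAbs = _
      omega
    rw [e, show ((3 * j + 1 : ℕ) : ℤ) = 3 * (j : ℤ) + 1 by push_cast; ring,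
      legendreSym_three_mul_add_one, show 3 * j + 1 - 1 = 2 * j + j by omega,
      zpow_natCast, pow_add, pow_mul]
    push_cast
    ring

theorem exp_absThreeMulAddOne (z : ℂ) (k : ℤ) :
    Complex.exp (2 * Real.pi * Complex.I * ((absThreeMulAddOne k : ℕ) : ℂ) ^ 2 * z / 3) =
      Complex.exp (2 * Real.pi * Complex.I * z / 3) *
        Complex.exp (2 * Real.pi * Complex.I * z) ^ (3 * k * k + 2 * k) := by
  have h : ((absThreeMulAddOne k : ℕ) : ℂ) ^ 2 = (3 * k + 1) ^ 2 := by
    have : ((absThreeMulAddOne k : ℕ) : ℤ) ^ 2 = (3 * k + 1) ^ 2 := Int.natAbs_sq _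
    exact_mod_cast congrArg (Int.cast : ℤ → ℂ) this
  rw [h, ← Complex.exp_int_mul, ← Complex.exp_add]
  push_cast
  ring_nf

theorem hasSum_eta_two_pow_five_div (τ : UpperHalfPlane) :
    HasSum
      (fun n : ℕ+ =>
        (-1 : ℂ) ^ ((n : ℕ) - 1) * ((n : ℕ) : ℂ) * ((legendreSym 3 ((n : ℕ) : ℤ) : ℤ) : ℂ) *
          Complex.exp (2 * (Real.pi : ℂ) * Complex.I * ((n : ℕ) : ℂ) ^ 2 * (τ : ℂ) / 3))
      (ModularForm.eta (2 * (τ : ℂ)) ^ 5 / ModularForm.eta (τ : ℂ) ^ 2) := by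
  have h1 := UpperHalfPlane.norm_exp_two_pi_I_lt_one τ
  have hq := Complex.exp_ne_zero (2 * Real.pi * Complex.I * (τ : ℂ))
  have H := (summable_linear_mul_neg_one_zpow hq h1).hasSum.mul_left
    (Complex.exp (2 * Real.pi * Complex.I * (τ : ℂ) / 3))
  rw [tsum_linear_mul_neg_one_zpow hq h1] at H
  rw [← absThreeMulAddOne_injective.hasSum_iff]
  · convert H using 1
    · rfl
    · funext k
      rw [Function.comp_apply, neg_one_pow_mul_legendreSym_absThreeMulAddOne,
        exp_absThreeMulAddOne]
      ring
    · have e1 := eta_natCast_mul 1 τ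
      have e2 := eta_natCast_mul 2 τ
      simp only [Nat.cast_one, Nat.cast_ofNat, one_mul, pow_one] at e1 e2
      -- The eta prefactors contribute (5·2 - 2)/24 = 1/3, the constant term of (3k+1)²/3.
      rw [e1, e2, mul_pow, mul_pow, mul_div_mul_comm, ← Complex.exp_nat_mul, ← Complex.exp_nat_mul,
        ← Complex.exp_sub]
      congr 2
      push_cast
      ring
  · intro n hn
    obtain ⟨k, hk⟩ := eq_three_mul_of_notMem_range hn
    rw [hk, legendreSym_three_mul]
    simp

/-! ### Bilateral Lambert series -/

/-- The coefficients `1 / (1 - p^(2m+1))` of the bilateral Lambert series. -/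
noncomputable def lambertCoeff (p : ℂ) (m : ℤ) : ℂ := (1 - p ^ (2 * m + 1))⁻¹

/-- The rapidly decaying part of `lambertCoeff`. -/
noncomputable def lambertTail (p : ℂ) (m : ℤ) : ℂ := lambertCoeff p m - if 0 ≤ m then 1 else 0

theorem one_sub_pow_ne_zero {p : ℂ} (h1 : ‖p‖ < 1) (n : ℕ) : 1 - p ^ (n + 1) ≠ 0 := by
  simpa [pow_succ'] using one_sub_mul_pow_ne_zero h1 h1 n

theorem one_sub_zpow_ne_zero {p : ℂ} (hp : p ≠ 0) (h1 : ‖p‖ < 1) (m : ℤ) :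
    1 - p ^ (2 * m + 1) ≠ 0 := by
  rcases lt_or_ge m 0 with hm | hm
  · obtain ⟨j, rfl⟩ : ∃ j : ℕ, m = -((j : ℤ) + 1) := ⟨(-m - 1).toNat, by omega⟩
    have h := one_sub_pow_ne_zero h1 (2 * j)
    rw [show 2 * (-((j : ℤ) + 1)) + 1 = -((2 * j + 1 : ℕ) : ℤ) by push_cast; ring, zpow_neg,
      zpow_natCast]
    intro h0
    apply h
    have h2 := pow_ne_zero (2 * j + 1) hp
    field_simp at h0
    linear_combination -h0
  · obtain ⟨j, rfl⟩ : ∃ j : ℕ, m = j := ⟨m.toNat, by omega⟩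
    exact_mod_cast one_sub_pow_ne_zero h1 (2 * j)

theorem lambertTail_natCast {p : ℂ} (h1 : ‖p‖ < 1) (n : ℕ) :
    lambertTail p n = p ^ (2 * n + 1) / (1 - p ^ (2 * n + 1)) := by
  have h := one_sub_pow_ne_zero h1 (2 * n)
  rw [lambertTail, lambertCoeff, if_pos (Int.natCast_nonneg n),
    show p ^ (2 * (n : ℤ) + 1) = p ^ (2 * n + 1) by exact_mod_cast zpow_natCast p (2 * n + 1)]
  field_simp
  ring

theorem lambertTail_neg {p : ℂ} (hp : p ≠ 0) (h1 : ‖p‖ < 1) (n : ℕ) :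
    lambertTail p (-((n : ℤ) + 1)) = -(p ^ (2 * n + 1) / (1 - p ^ (2 * n + 1))) := by
  have h := one_sub_pow_ne_zero h1 (2 * n)
  have h' := one_sub_zpow_ne_zero hp h1 (-((n : ℤ) + 1))
  have h2 := pow_ne_zero (2 * n + 1) hp
  have e : p ^ (2 * (-((n : ℤ) + 1)) + 1) = (p ^ (2 * n + 1))⁻¹ := by
    rw [show 2 * (-((n : ℤ) + 1)) + 1 = -((2 * n + 1 : ℕ) : ℤ) by push_cast; ring, zpow_neg,
      zpow_natCast]
  rw [e] at h'
  rw [lambertTail, lambertCoeff, if_neg (by omega), e, sub_zero, inv_eq_iff_eq_inv, ← neg_inv,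
    inv_div]
  field_simp
  ring

theorem norm_pow_div_one_sub_pow_le {p : ℂ} (h1 : ‖p‖ < 1) (n : ℕ) :
    ‖p ^ (2 * n + 1) / (1 - p ^ (2 * n + 1))‖ ≤ ‖p ^ 2‖ ^ n * (1 - ‖p‖)⁻¹ := by
  have h0 := norm_nonneg p
  rw [norm_div, div_eq_mul_inv, norm_pow, norm_pow, ← pow_mul]
  have hle : ‖p‖ ^ (2 * n + 1) ≤ ‖p‖ := pow_le_of_le_one h0 h1.le (by omega)
  have h3 : 1 - ‖p‖ ≤ ‖1 - p ^ (2 * n + 1)‖ := by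
    have := norm_sub_norm_le 1 (p ^ (2 * n + 1))
    rw [norm_one, norm_pow] at this
    linarith
  have h4 : 0 < 1 - ‖p‖ := by linarith
  gcongr ?_ * ?_
  · exact pow_le_pow_of_le_one h0 h1.le (by omega)
  · exact inv_anti₀ h4 h3

theorem summable_mul_lambertTail {p : ℂ} (hp : p ≠ 0) (h1 : ‖p‖ < 1) {χ : ℤ → ℂ}
    (ha : Summable fun n : ℕ => ‖χ n‖ * ‖p ^ 2‖ ^ n)
    (hb : Summable fun n : ℕ => ‖χ (-((n : ℤ) + 1))‖ * ‖p ^ 2‖ ^ n) :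
    Summable fun m : ℤ => ‖χ m * lambertTail p m‖ := by
  refine Summable.of_nat_of_neg_add_one ?_ ?_
  · refine Summable.of_nonneg_of_le (fun _ => norm_nonneg _) (fun n => ?_)
      (ha.mul_right (1 - ‖p‖)⁻¹)
    rw [norm_mul, lambertTail_natCast h1, mul_assoc]
    gcongr
    exact norm_pow_div_one_sub_pow_le h1 n
  · refine Summable.of_nonneg_of_le (fun _ => norm_nonneg _) (fun n => ?_)
      (hb.mul_right (1 - ‖p‖)⁻¹)
    rw [norm_mul, lambertTail_neg hp h1, norm_neg, mul_assoc]
    gcongr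
    exact norm_pow_div_one_sub_pow_le h1 n

theorem summable_lambertTail {p : ℂ} (hp : p ≠ 0) (h1 : ‖p‖ < 1) :
    Summable fun m : ℤ => ‖lambertTail p m‖ := by
  have h := summable_geometric_of_lt_one (norm_nonneg (p ^ 2)) (norm_sq_lt_one h1)
  simpa using summable_mul_lambertTail hp h1 (χ := fun _ => 1) (by simpa using h) (by simpa using h)

theorem summable_intCast_mul_lambertTail {p : ℂ} (hp : p ≠ 0) (h1 : ‖p‖ < 1) :
    Summable fun m : ℤ => ‖(m : ℂ) * lambertTail p m‖ := by
  have h2 : ‖‖p ^ 2‖‖ < 1 := by simpa using norm_sq_lt_one h1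
  have h := summable_geometric_of_lt_one (norm_nonneg (p ^ 2)) (norm_sq_lt_one h1)
  have h' : Summable fun n : ℕ => (n : ℝ) * ‖p ^ 2‖ ^ n := by
    simpa using summable_pow_mul_geometric_of_norm_lt_one 1 h2
  refine summable_mul_lambertTail hp h1 (by simpa using h') ((h'.add h).congr fun n => ?_)
  rw [Complex.norm_intCast]
  push_cast
  rw [abs_neg, abs_of_nonneg (by positivity)]
  ring

/-- The coefficients tend to 1 at +∞, which needs |y| < 1, and decay like p^(2|m|) at -∞, which
needs |p²| < |y|. -/
theorem summable_zpow_mul_lambertCoeff {p y : ℂ} (hp : p ≠ 0) (h1 : ‖p‖ < 1) (hy : ‖p ^ 2‖ < ‖y‖)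
    (hy1 : ‖y‖ < 1) : Summable fun m : ℤ => ‖y ^ m * lambertCoeff p m‖ := by
  have hy0 : 0 < ‖y‖ := (norm_nonneg _).trans_lt hy
  have h : Summable fun m : ℤ => ‖y ^ m * lambertTail p m‖ := by
    refine summable_mul_lambertTail hp h1 ?_ ?_
    · have := summable_geometric_of_lt_one (r := ‖y‖ * ‖p ^ 2‖) (by positivity)
        (mul_lt_one_of_nonneg_of_lt_one_left (norm_nonneg _) hy1 (norm_sq_lt_one h1).le)
      simpa [mul_pow] using this
    · have := (summable_geometric_of_lt_one (r := ‖y‖⁻¹ * ‖p ^ 2‖) (by positivity)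
        (by rwa [inv_mul_lt_one₀ hy0])).mul_left ‖y‖⁻¹
      refine this.congr fun n => ?_
      rw [norm_zpow, zpow_neg, zpow_add_one₀ hy0.ne', zpow_natCast, mul_inv, mul_pow, inv_pow]
      ring
  have h' : Summable fun m : ℤ => ‖y ^ m * if 0 ≤ m then (1 : ℂ) else 0‖ := by
    refine Summable.of_nat_of_neg_add_one ?_ ?_
    · simpa using summable_geometric_of_lt_one hy0.le hy1
    · refine summable_zero.congr fun n => ?_
      rw [if_neg (by omega)]
      simp
  refine Summable.of_nonneg_of_le (fun _ => norm_nonneg _) (fun m => ?_) (h.add h')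
  refine le_trans (le_of_eq ?_) (norm_add_le _ _)
  rw [lambertTail]
  congr 1
  ring

/-! ### Theta series times Lambert series -/

/-- The convolution of the theta coefficients with the Lambert coefficients. -/
noncomputable def thetaLambert (p : ℂ) (N : ℤ) : ℂ :=
  ∑' m : ℤ, thetaCoeff p (N - m) * lambertCoeff p m

theorem summable_thetaCoeff {p : ℂ} (hp : p ≠ 0) (h1 : ‖p‖ < 1) :
    Summable fun n : ℤ => ‖thetaCoeff p n‖ := by
  simpa using summable_linear_mul_zpow_mul_thetaCoeff hp h1 1 0 1

theorem summable_thetaCoeff_sub {p : ℂ} (hp : p ≠ 0) (h1 : ‖p‖ < 1) (N : ℤ) :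
    Summable fun m : ℤ => ‖thetaCoeff p (N - m)‖ :=
  ((Equiv.subLeft N).summable_iff.mpr (summable_thetaCoeff hp h1) :)

theorem summable_thetaLambert {p : ℂ} (hp : p ≠ 0) (h1 : ‖p‖ < 1) (N : ℤ) :
    Summable fun m : ℤ => thetaCoeff p (N - m) * lambertCoeff p m := by
  have e : ∀ m, thetaCoeff p (N - m) * lambertCoeff p m =
      thetaCoeff p (N - 1 * m) * lambertTail p m +
        thetaCoeff p (N - m) * if 0 ≤ m then (1 : ℂ) else 0 := by
    intro m
    rw [lambertTail, one_mul]
    ring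
  simp only [e]
  refine (summable_convolution_factor 1 (summable_thetaCoeff hp h1)
    (summable_lambertTail hp h1) N).add (Summable.of_norm_bounded
      (summable_thetaCoeff_sub hp h1 N) fun m => ?_)
  split_ifs <;> simp

/-- The shift of the theta coefficients supplies exactly the factor 1 - p^(2m+1) that cancels the
Lambert denominator; the remaining sum is θ(1) = 0. -/
theorem thetaLambert_add_one {p : ℂ} (hp : p ≠ 0) (h1 : ‖p‖ < 1) (N : ℤ) :
    thetaLambert p (N + 1) = -p ^ (2 * N + 3) * thetaLambert p N := by
  have h0 : ∑' m : ℤ, thetaCoeff p (N + 1 - m) = 0 := by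
    rw [← tsum_thetaCoeff hp h1, ← (Equiv.subLeft (N + 1)).tsum_eq (thetaCoeff p)]
    rfl
  have h := (summable_thetaLambert hp h1 (N + 1)).tsum_add
    ((summable_thetaLambert hp h1 N).mul_left (p ^ (2 * N + 3)))
  rw [tsum_mul_left, ← thetaLambert, ← thetaLambert] at h
  have e : ∀ m : ℤ, thetaCoeff p (N + 1 - m) * lambertCoeff p m +
      p ^ (2 * N + 3) * (thetaCoeff p (N - m) * lambertCoeff p m) = thetaCoeff p (N + 1 - m) := by
    intro m
    have hz : p ^ (2 * N + 3) = p ^ (2 * (N - m) + 2) * p ^ (2 * m + 1) := by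
      rw [← zpow_add₀ hp]
      congr 1
      ring
    rw [hz, show N + 1 - m = N - m + 1 by ring, thetaCoeff_add_one hp, lambertCoeff]
    have h3 := one_sub_zpow_ne_zero hp h1 m
    generalize p ^ (2 * m + 1) = x at *
    generalize p ^ (2 * (N - m) + 2) = y at *
    field_simp
    ring
  simp only [e, h0] at h
  linear_combination -h

theorem thetaLambert_eq {p : ℂ} (hp : p ≠ 0) (h1 : ‖p‖ < 1) (N : ℤ) :
    thetaLambert p N = p ^ N * thetaCoeff p N * thetaLambert p 0 := by
  have step (N : ℤ) : p ^ (N + 1) * thetaCoeff p (N + 1) =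
      -p ^ (2 * N + 3) * (p ^ N * thetaCoeff p N) := by
    rw [thetaCoeff_add_one hp, show 2 * N + 3 = (2 * N + 2) + 1 by ring, zpow_add_one₀ hp,
      zpow_add_one₀ hp]
    ring
  induction N using Int.induction_on with
  | zero => simp [thetaCoeff]
  | succ i ih => rw [thetaLambert_add_one hp h1, step, ih]; ring
  | pred i ih =>
    have h2 := thetaLambert_add_one hp h1 (-(i : ℤ) - 1)
    have h3 := step (-(i : ℤ) - 1)
    rw [sub_add_cancel] at h2 h3
    rw [h2, h3] at ih
    have h4 : -p ^ (2 * (-(i : ℤ) - 1) + 3) ≠ 0 := neg_ne_zero.mpr (zpow_ne_zero _ hp)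
    apply mul_left_cancel₀ h4
    rw [ih]
    ring

/-- The product of the theta series and the bilateral Lambert series. -/
theorem tsum_thetaCoeff_mul_tsum_lambertCoeff {p y : ℂ} (hp : p ≠ 0) (h1 : ‖p‖ < 1)
    (hy : ‖p ^ 2‖ < ‖y‖) (hy1 : ‖y‖ < 1) :
    (∑' n : ℤ, y ^ n * thetaCoeff p n) * (∑' m : ℤ, y ^ m * lambertCoeff p m) =
      thetaLambert p 0 * ∑' n : ℤ, (p * y) ^ n * thetaCoeff p n := by
  have hy0 : y ≠ 0 := norm_pos_iff.mp ((norm_nonneg _).trans_lt hy)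
  rw [← (hasSum_convolution 1 (summable_zpow_mul_thetaCoeff hp h1 y)
    (summable_zpow_mul_lambertCoeff hp h1 hy hy1)).tsum_eq, ← tsum_mul_left]
  refine tsum_congr fun N => ?_
  have e : ∀ m : ℤ, y ^ (N - 1 * m) * thetaCoeff p (N - 1 * m) * (y ^ m * lambertCoeff p m) =
      y ^ N * (thetaCoeff p (N - m) * lambertCoeff p m) := by
    intro m
    rw [one_mul, zpow_sub₀ hy0]
    field_simp
  simp only [e]
  rw [tsum_mul_left, ← thetaLambert, thetaLambert_eq hp h1, mul_zpow]
  ring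

theorem lambertCoeff_sub_eq (p : ℂ) (m : ℤ) :
    lambertCoeff p m - lambertCoeff p (m - 1) =
      lambertTail p m - lambertTail p (m - 1) + if m = 0 then 1 else 0 := by
  rw [lambertTail, lambertTail]
  split_ifs <;> first | omega | ring

theorem tsum_intCast_mul_thetaCoeff {p : ℂ} (hp : p ≠ 0) (h1 : ‖p‖ < 1) :
    ∑' n : ℤ, (n : ℂ) * thetaCoeff p n = qPochInf (p ^ 2) (p ^ 2) ^ 3 := by
  have h := tsum_two_mul_add_one_mul_thetaCoeff hp h1
  have s : Summable fun n : ℤ => ‖(n : ℂ) * thetaCoeff p n‖ := by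
    simpa using summable_linear_mul_zpow_mul_thetaCoeff hp h1 1 1 0
  have e (n : ℤ) : (2 * n + 1) * thetaCoeff p n =
    2 * ((n : ℂ) * thetaCoeff p n) + thetaCoeff p n := by ring
  simp only [e] at h
  rw [(s.of_norm.mul_left 2).tsum_add (summable_thetaCoeff hp h1).of_norm, tsum_mul_left,
    tsum_thetaCoeff hp h1] at h
  linear_combination h / 2

/-- Evaluation of the constant in the product formula for the Lambert series. -/
theorem thetaLambert_zero_mul {p : ℂ} (hp : p ≠ 0) (h1 : ‖p‖ < 1) :
    thetaLambert p 0 * ∑' n : ℤ, p ^ n * thetaCoeff p n = -qPochInf (p ^ 2) (p ^ 2) ^ 3 := by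
  have t0 := summable_lambertTail hp h1
  have t1 := summable_intCast_mul_lambertTail hp h1
  have u0 : Summable fun m : ℤ => ‖lambertTail p (m - 1)‖ :=
    ((Equiv.subRight (1 : ℤ)).summable_iff.mpr t0 :)
  have u1 : Summable fun m : ℤ => ‖((m - 1 : ℤ) : ℂ) * lambertTail p (m - 1)‖ :=
    ((Equiv.subRight (1 : ℤ)).summable_iff.mpr t1 :)
  -- Formally θ(y) has a zero and the Lambert series a pole at y = 1. Differencing multiplies the
  -- latter by 1 - y, so the comparison can be made at y = 1 itself; the weight N plays the role of
  -- a derivative in y.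
  set D : ℤ → ℂ := fun m => lambertCoeff p m - lambertCoeff p (m - 1) with hD
  have hD0 : Summable fun m => ‖D m‖ := by
    have hi : Summable fun m : ℤ => ‖(if m = 0 then 1 else 0 : ℂ)‖ :=
      summable_of_ne_finset_zero (s := {0}) fun m hm => by simp_all
    refine Summable.of_nonneg_of_le (fun _ => norm_nonneg _) (fun m => ?_) ((t0.add u0).add hi)
    rw [hD]
    simp only [lambertCoeff_sub_eq]
    exact (norm_add_le _ _).trans (by gcongr; exact norm_sub_le _ _)
  have hD1 : Summable fun m : ℤ => ‖(m : ℂ) * D m‖ := by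
    refine Summable.of_nonneg_of_le (fun _ => norm_nonneg _) (fun m => ?_) ((t1.add u1).add u0)
    have e : (m : ℂ) * D m = (m : ℂ) * lambertTail p m -
        ((m - 1 : ℤ) : ℂ) * lambertTail p (m - 1) - lambertTail p (m - 1) := by
      simp only [hD, lambertCoeff_sub_eq]
      split_ifs with h
      · subst h; push_cast; ring
      · push_cast; ring
    rw [e]
    exact (norm_sub_le _ _).trans (by gcongr; exact norm_sub_le _ _)
  -- The tails telescope; the jump of the step function at 0 leaves 1.
  have hDsum : ∑' m, D m = 1 := by
    have hshift : ∑' m : ℤ, lambertTail p (m - 1) = ∑' m : ℤ, lambertTail p m :=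
      (Equiv.subRight (1 : ℤ)).tsum_eq (lambertTail p)
    simp only [hD, lambertCoeff_sub_eq]
    rw [(t0.of_norm.sub u0.of_norm).tsum_add
      (summable_of_ne_finset_zero (s := {0}) fun m hm => by simp_all),
      t0.of_norm.tsum_sub u0.of_norm, hshift, sub_self, zero_add, tsum_ite_eq]
  have s1 : Summable fun n : ℤ => ‖(n : ℂ) * thetaCoeff p n‖ := by
    simpa using summable_linear_mul_zpow_mul_thetaCoeff hp h1 1 1 0
  have H := hasSum_mul_convolution 1 (summable_thetaCoeff hp h1) s1 hD0 hD1
  rw [tsum_intCast_mul_thetaCoeff hp h1, hDsum, tsum_thetaCoeff hp h1] at H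
  have hconv (N : ℤ) : ∑' m : ℤ, thetaCoeff p (N - 1 * m) * D m =
      thetaLambert p N - thetaLambert p (N - 1) := by
    have hs : Summable fun m : ℤ => thetaCoeff p (N - m) * lambertCoeff p (m - 1) := by
      have := (Equiv.subRight (1 : ℤ)).summable_iff.mpr (summable_thetaLambert hp h1 (N - 1))
      refine this.congr fun m => ?_
      simp
    have e : ∑' m : ℤ, thetaCoeff p (N - m) * lambertCoeff p (m - 1) = thetaLambert p (N - 1) := by
      rw [thetaLambert, ← (Equiv.subRight (1 : ℤ)).tsum_eq
        fun m => thetaCoeff p (N - 1 - m) * lambertCoeff p m]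
      exact tsum_congr fun m => by simp
    rw [← e, thetaLambert, ← (summable_thetaLambert hp h1 N).tsum_sub hs]
    exact tsum_congr fun m => by rw [one_mul, mul_sub]
  simp only [hconv] at H
  -- summation by parts
  have v0 : Summable fun N : ℤ => thetaLambert p N := by
    exact ((summable_zpow_mul_thetaCoeff hp h1 p).of_norm.mul_right _).congr
      fun N => (thetaLambert_eq hp h1 N).symm
  have v1 : Summable fun N : ℤ => (N : ℂ) * thetaLambert p N := by
    have := (summable_linear_mul_zpow_mul_thetaCoeff hp h1 p 1 0).of_norm.mul_right
      (thetaLambert p 0)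
    refine this.congr fun N => ?_
    rw [thetaLambert_eq hp h1 N]
    ring
  have w : HasSum (fun N : ℤ => (N : ℂ) * thetaLambert p (N - 1))
      (∑' N : ℤ, (N : ℂ) * thetaLambert p N + ∑' N : ℤ, thetaLambert p N) := by
    rw [← (Equiv.addRight (1 : ℤ)).hasSum_iff]
    convert v1.hasSum.add v0.hasSum using 2 with N
    simp
    ring
  have H' := v1.hasSum.sub w
  simp only [← mul_sub] at H'
  have h := H.unique H'
  rw [tsum_congr (thetaLambert_eq hp h1), tsum_mul_right] at h
  push_cast at h
  linear_combination h

/-! ### Product evaluation of the Lambert series -/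

theorem mul_qPochInf_inv_mul_qPochInf {z : ℂ} (hz : z ≠ 0) {q : ℂ} (hq : ‖q‖ < 1) :
    z * (qPochInf z⁻¹ q * qPochInf (q * z) q) = -(qPochInf z q * qPochInf (q * z⁻¹) q) := by
  rw [qPochInf_eq_one_sub_mul z⁻¹ hq, qPochInf_eq_one_sub_mul z hq, mul_comm z⁻¹, mul_comm z q]
  field_simp
  ring

theorem hasSum_of_forall_eq {ι : Type*} {f g : ι → ℂ} {a : ℂ} (h : HasSum g a)
    (e : ∀ x, f x = g x) : HasSum f a :=
  (funext e : f = g) ▸ h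

theorem tsum_zpow_mul_lambertCoeff {q : ℂ} (hq : q ≠ 0) (h1 : ‖q‖ < 1) :
    ∑' m : ℤ, (q ^ 2) ^ m * lambertCoeff (q ^ 3) m =
      qPochInf q q * qPochInf (q ^ 6) (q ^ 6) ^ 6 /
        (qPochInf (q ^ 2) (q ^ 2) ^ 2 * qPochInf (q ^ 3) (q ^ 3) ^ 3) := by
  have h2 := norm_pow_lt_one_of_ne_zero h1 (show 2 ≠ 0 by norm_num)
  have h3 := norm_pow_lt_one_of_ne_zero h1 (show 3 ≠ 0 by norm_num)
  have h6 := norm_pow_lt_one_of_ne_zero h1 (show 6 ≠ 0 by norm_num)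
  have hA (k : ℕ) (hk : k ≠ 0) : qPochInf (q ^ k) (q ^ 6) ≠ 0 :=
    qPochInf_ne_zero (norm_pow_lt_one_of_ne_zero h1 hk) h6
  have n3 := pow_ne_zero 3 hq
  -- The theta arguments are y = q² and py = q⁵; `K2` uses q³. The reflections `T2`, `T5`, `T3` then
  -- express everything through A_i = (q^i; q⁶)_∞.
  have K1 := tsum_thetaCoeff_mul_tsum_lambertCoeff (p := q ^ 3) (y := q ^ 2) n3 h3
    (by
      rw [← pow_mul, norm_pow, norm_pow]
      exact pow_lt_pow_right_of_lt_one₀ (norm_pos_iff.mpr hq) h1 (by norm_num)) h2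
  have K2 := thetaLambert_zero_mul n3 h3
  rw [← pow_add] at K1
  rw [tsum_zpow_mul_thetaCoeff n3 h3 (pow_ne_zero _ hq),
    tsum_zpow_mul_thetaCoeff n3 h3 (pow_ne_zero _ hq), mul_assoc (qPochInf _ _),
    mul_assoc (qPochInf _ _)] at K1
  rw [tsum_zpow_mul_thetaCoeff n3 h3 (pow_ne_zero _ hq), mul_assoc (qPochInf _ _)] at K2
  rw [← pow_mul] at K1 K2
  have T2 := mul_qPochInf_inv_mul_qPochInf (pow_ne_zero 2 hq) h6
  have T3 := mul_qPochInf_inv_mul_qPochInf (pow_ne_zero 3 hq) h6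
  have T5 := mul_qPochInf_inv_mul_qPochInf (pow_ne_zero 5 hq) h6
  rw [show q ^ 6 * (q ^ 2)⁻¹ = q ^ 4 by field_simp] at T2
  rw [show q ^ 6 * (q ^ 3)⁻¹ = q ^ 3 by field_simp] at T3
  rw [show q ^ 6 * (q ^ 5)⁻¹ = q ^ 1 by field_simp] at T5
  have P1 := qPochInf_eq_prod q h1 6
  have P2 := qPochInf_eq_prod (q ^ 2) h2 3
  have P3 := qPochInf_eq_prod (q ^ 3) h3 2
  simp only [Fin.prod_univ_six, Fin.prod_univ_three, Fin.prod_univ_two, Fin.coe_ofNat_eq_mod,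
    Nat.reduceMod, mul_one, pow_one, ← pow_succ', ← pow_mul, Nat.reduceMul, ← pow_add,
    Nat.reduceAdd] at P1 P2 P3 K1 K2 T2 T3 T5
  rw [P1, P2, P3]
  have a1 := hA 1 one_ne_zero
  have a2 := hA 2 (by norm_num)
  have a3 := hA 3 (by norm_num)
  have a4 := hA 4 (by norm_num)
  have a5 := hA 5 (by norm_num)
  have a6 := hA 6 (by norm_num)
  rw [pow_one] at a1
  generalize qPochInf q (q ^ 6) = A₁ at *
  generalize qPochInf (q ^ 2) (q ^ 6) = A₂ at *
  generalize qPochInf (q ^ 3) (q ^ 6) = A₃ at *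
  generalize qPochInf (q ^ 4) (q ^ 6) = A₄ at *
  generalize qPochInf (q ^ 5) (q ^ 6) = A₅ at *
  generalize qPochInf (q ^ 6) (q ^ 6) = A₆ at *
  generalize qPochInf (q ^ 2)⁻¹ (q ^ 6) = u₂ at *
  generalize qPochInf (q ^ 8) (q ^ 6) = v₂ at *
  generalize qPochInf (q ^ 3)⁻¹ (q ^ 6) = u₃ at *
  generalize qPochInf (q ^ 9) (q ^ 6) = v₃ at *
  generalize qPochInf (q ^ 5)⁻¹ (q ^ 6) = u₅ at *
  generalize qPochInf (q ^ 11) (q ^ 6) = v₅ at *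
  generalize thetaLambert (q ^ 3) 0 = c at *
  generalize ∑' m : ℤ, (q ^ 2) ^ m * lambertCoeff (q ^ 3) m = S at *
  have c1 : c * A₃ ^ 2 = q ^ 3 * A₆ ^ 2 := by
    apply mul_left_cancel₀ a6
    linear_combination c * A₆ * T3 - q ^ 3 * K2
  have c2 : S * (A₂ * A₄) * q ^ 3 = c * (A₅ * A₁) := by
    apply mul_left_cancel₀ a6
    linear_combination -q ^ 5 * K1 + S * A₆ * q ^ 3 * T2 - c * A₆ * T5
  have c3 : S * (A₂ * A₄) * A₃ ^ 2 = A₆ ^ 2 * (A₅ * A₁) := by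
    apply mul_left_cancel₀ n3
    linear_combination A₃ ^ 2 * c2 + A₅ * A₁ * c1
  rw [eq_div_iff (by positivity)]
  linear_combination A₂ * A₄ * A₃ * A₆ ^ 5 * c3

/-! ### Divisor sums as Lambert series -/

theorem tsum_pnat_character_mul_pow {r : ℂ} (hr : ‖r‖ < 1) :
    HasSum (fun d : ℕ+ => ((if (d : ℕ) ≡ 1 [MOD 3] then 1 else 0) -
      (if (d : ℕ) ≡ 2 [MOD 3] then 1 else 0)) * r ^ (d : ℕ)) ((r - r ^ 2) / (1 - r ^ 3)) := by
  set f : ℕ → ℂ := fun d => ((if d ≡ 1 [MOD 3] then 1 else 0) -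
      (if d ≡ 2 [MOD 3] then 1 else 0)) * r ^ d with hf
  have hs : Summable f := by
    refine Summable.of_norm_bounded (summable_geometric_of_lt_one (norm_nonneg r) hr) fun d => ?_
    rw [hf, norm_mul, norm_pow]
    refine mul_le_of_le_one_left (by positivity) ?_
    split_ifs with h h'
    · exact absurd (h.symm.trans h') (by decide)
    all_goals simp
  have h0 : HasSum (fun d : ℕ+ => f d) (∑' d, f d) := by
    refine (PNat.coe_injective.hasSum_iff fun n hn => ?_).mpr hs.hasSum
    obtain rfl : n = 0 := by
      by_contra h
      exact hn ⟨⟨n, Nat.pos_of_ne_zero h⟩, rfl⟩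
    simp [hf, Nat.ModEq]
  have h1 := hs.sum_add_tsum_nat_add 3
  have e (d : ℕ) : f (d + 3) = r ^ 3 * f d := by
    simp only [hf, Nat.ModEq, Nat.add_mod_right]
    ring_nf
  have h3 : 1 - r ^ 3 ≠ 0 := one_sub_pow_ne_zero hr 2
  simp only [e, tsum_mul_left, Finset.sum_range_succ, Finset.sum_range_zero] at h1
  have h2 : ∑' d, f d = (r - r ^ 2) / (1 - r ^ 3) := by
    rw [eq_div_iff h3]
    simp [hf, Nat.ModEq] at h1 ⊢
    linear_combination -h1
  rwa [h2] at h0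

/-- The summand of the double series for `∑ (d*₁,₃(n) - d*₂,₃(n)) qⁿ`. -/
noncomputable def divisorTerm (q : ℂ) (d e : ℕ) : ℂ :=
  ((if d ≡ 1 [MOD 3] then 1 else 0) - (if d ≡ 2 [MOD 3] then 1 else 0)) *
    ((if Odd e then 1 else 0) * q ^ (d * e))

theorem summable_divisorTerm {q : ℂ} (h1 : ‖q‖ < 1) :
    Summable fun x : ℕ+ × ℕ+ => divisorTerm q x.1 x.2 := by
  have h := (summable_prod_mul_pow 0 h1).norm
  simp only [pow_zero, one_mul] at h
  refine Summable.of_norm_bounded h fun x => ?_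
  rw [divisorTerm, norm_mul]
  refine (mul_le_of_le_one_left (norm_nonneg _) ?_).trans ?_
  · split_ifs with h h'
    · exact absurd (h.symm.trans h') (by decide)
    all_goals simp
  · split_ifs <;> simp

theorem sum_divisorTerm (q : ℂ) (n : ℕ) :
    ∑ x ∈ n.divisorsAntidiagonal, divisorTerm q x.1 x.2 =
      ((dStar 1 3 n : ℂ) - (dStar 2 3 n : ℂ)) * q ^ n := by
  rw [Nat.sum_divisorsAntidiagonal (fun d e => divisorTerm q d e), dStar, dStar,
    Finset.card_filter, Finset.card_filter]
  push_cast
  rw [← Finset.sum_sub_distrib, Finset.sum_mul]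
  refine Finset.sum_congr rfl fun d hd => ?_
  rw [divisorTerm, Nat.mul_div_cancel' (Nat.dvd_of_mem_divisors hd)]
  by_cases h : Odd (n / d) <;> simp [h]

theorem hasSum_dStar {q : ℂ} (h1 : ‖q‖ < 1) :
    HasSum (fun n : ℕ+ => ((dStar 1 3 n : ℂ) - (dStar 2 3 n : ℂ)) * q ^ (n : ℕ))
      (∑' x : ℕ+ × ℕ+, divisorTerm q x.1 x.2) := by
  have h := (summable_divisorTerm h1).hasSum
  rw [← sigmaAntidiagonalEquivProd.hasSum_iff] at h
  refine h.sigma fun n => ?_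
  rw [← sum_divisorTerm, ← Finset.sum_coe_sort]
  exact hasSum_fintype _

theorem hasSum_odd_lambert {q : ℂ} (h1 : ‖q‖ < 1) :
    HasSum (fun k : ℕ => (q ^ (2 * k + 1) - (q ^ (2 * k + 1)) ^ 2) / (1 - (q ^ (2 * k + 1)) ^ 3))
      (∑' x : ℕ+ × ℕ+, divisorTerm q x.1 x.2) := by
  have h := (summable_divisorTerm h1).hasSum
  rw [← (Equiv.prodComm ℕ+ ℕ+).hasSum_iff] at h
  have h' := h.prod_fiberwise (g := fun e : ℕ+ => if Odd (e : ℕ) then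
      (q ^ (e : ℕ) - (q ^ (e : ℕ)) ^ 2) / (1 - (q ^ (e : ℕ)) ^ 3) else 0) fun e => by
    have := tsum_pnat_character_mul_pow (norm_pow_lt_one_of_ne_zero h1 e.ne_zero)
    split_ifs with he
    · refine hasSum_of_forall_eq this fun d => ?_
      simp [divisorTerm, he, ← pow_mul, mul_comm (e : ℕ)]
    · simp [divisorTerm, he]
  have hinj : Function.Injective fun k : ℕ => (⟨2 * k + 1, by omega⟩ : ℕ+) := fun a b hab => by
    have : 2 * a + 1 = 2 * b + 1 := congrArg PNat.val hab
    omega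
  refine hasSum_of_forall_eq ((hinj.hasSum_iff fun e he => ?_).mpr h') fun k => ?_
  · rw [if_neg]
    rintro ⟨k, hk⟩
    exact he ⟨k, PNat.eq hk.symm⟩
  · exact (if_pos ⟨k, rfl⟩).symm

/-- With r = q^(2k+1), the indices m = k and m = -(k+1) contribute r/(1-r³) and -r²/(1-r³), the two
parts of the sum over d for e = 2k+1. -/
theorem tsum_divisorTerm {q : ℂ} (hq : q ≠ 0) (h1 : ‖q‖ < 1) :
    ∑' x : ℕ+ × ℕ+, divisorTerm q x.1 x.2 =
      q * ∑' m : ℤ, (q ^ 2) ^ m * lambertCoeff (q ^ 3) m := by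
  have h3 := norm_pow_lt_one_of_ne_zero h1 (show 3 ≠ 0 by norm_num)
  have h2 := norm_pow_lt_one_of_ne_zero h1 (show 2 ≠ 0 by norm_num)
  have s := summable_zpow_mul_lambertCoeff (p := q ^ 3) (y := q ^ 2) (pow_ne_zero 3 hq) h3 (by
      rw [← pow_mul, norm_pow, norm_pow]
      exact pow_lt_pow_right_of_lt_one₀ (norm_pos_iff.mpr hq) h1 (by norm_num)) h2
  have H := (s.of_norm.hasSum.mul_left q).nat_add_neg_add_one
  refine (hasSum_odd_lambert h1).unique (hasSum_of_forall_eq H fun k => ?_)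
  have hr := one_sub_pow_ne_zero h3 (2 * k)
  have hr0 : q ^ (2 * k + 1) ≠ 0 := pow_ne_zero _ hq
  have e1 : q * (q ^ 2) ^ (k : ℤ) = q ^ (2 * k + 1) := by
    rw [zpow_natCast]; ring
  have e2 : q * (q ^ 2) ^ (-((k : ℤ) + 1)) = (q ^ (2 * k + 1))⁻¹ := by
    rw [zpow_neg, zpow_add_one₀ (pow_ne_zero 2 hq), zpow_natCast]
    field_simp
    ring
  have e3 : (q ^ 3) ^ (2 * (k : ℤ) + 1) = (q ^ (2 * k + 1)) ^ 3 := by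
    rw [show 2 * (k : ℤ) + 1 = ((2 * k + 1 : ℕ) : ℤ) by push_cast; ring, zpow_natCast]
    ring
  have e4 : (q ^ 3) ^ (2 * (-((k : ℤ) + 1)) + 1) = ((q ^ (2 * k + 1)) ^ 3)⁻¹ := by
    rw [← e3, ← zpow_neg]
    congr 1
  have hr' : 1 - (q ^ (2 * k + 1)) ^ 3 ≠ 0 := by
    rwa [← pow_mul, mul_comm, pow_mul]
  have hr'' : (q ^ (2 * k + 1)) ^ 3 - 1 ≠ 0 := by
    rw [← neg_sub]; exact neg_ne_zero.mpr hr'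
  rw [← mul_assoc, ← mul_assoc, e1, e2, lambertCoeff, lambertCoeff, e3, e4]
  generalize q ^ (2 * k + 1) = r at *
  have e5 : (1 - (r ^ 3)⁻¹)⁻¹ = -r ^ 3 / (1 - r ^ 3) := by
    rw [inv_eq_iff_eq_inv, inv_div]
    field_simp
    ring
  rw [e5]
  field_simp
  ring

/-! ### The two identities together -/

theorem mainTheorem5 (τ : UpperHalfPlane) :
    HasSum
      (fun n : ℕ+ =>
        (-1 : ℂ) ^ ((n : ℕ) - 1) * ((n : ℕ) : ℂ) * ((legendreSym 3 ((n : ℕ) : ℤ) : ℤ) : ℂ) *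
          Complex.exp (2 * (Real.pi : ℂ) * Complex.I * ((n : ℕ) : ℂ) ^ 2 * (τ : ℂ) / 3))
      (ModularForm.eta (2 * (τ : ℂ)) ^ 5 / ModularForm.eta (τ : ℂ) ^ 2) ∧
    HasSum
      (fun n : ℕ+ =>
        ((dStar 1 3 (n : ℕ) : ℂ) - (dStar 2 3 (n : ℕ) : ℂ)) *
          Complex.exp (2 * (Real.pi : ℂ) * Complex.I * (τ : ℂ)) ^ (n : ℕ))
      (ModularForm.eta (τ : ℂ) * ModularForm.eta (6 * (τ : ℂ)) ^ 6 /
        (ModularForm.eta (2 * (τ : ℂ)) ^ 2 * ModularForm.eta (3 * (τ : ℂ)) ^ 3)) := by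
  refine ⟨hasSum_eta_two_pow_five_div τ, ?_⟩
  have h1 := UpperHalfPlane.norm_exp_two_pi_I_lt_one τ
  have hq := Complex.exp_ne_zero (2 * Real.pi * Complex.I * (τ : ℂ))
  have H := hasSum_dStar h1
  rw [tsum_divisorTerm hq h1, tsum_zpow_mul_lambertCoeff hq h1] at H
  convert H using 1
  have e1 := eta_natCast_mul 1 τ
  have e2 := eta_natCast_mul 2 τ
  have e3 := eta_natCast_mul 3 τ
  have e6 := eta_natCast_mul 6 τ
  simp only [Nat.cast_one, Nat.cast_ofNat, one_mul, pow_one] at e1 e2 e3 e6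
  -- The eta prefactors contribute (1 + 36 - 4 - 9)/24 = 1, the factor q in front of the Lambert
  -- series.
  have e : Complex.exp (2 * Real.pi * Complex.I * τ) =
      Complex.exp (2 * Real.pi * Complex.I * τ / 24) *
        Complex.exp (2 * Real.pi * Complex.I * (6 * τ) / 24) ^ 6 /
      (Complex.exp (2 * Real.pi * Complex.I * (2 * τ) / 24) ^ 2 *
        Complex.exp (2 * Real.pi * Complex.I * (3 * τ) / 24) ^ 3) := by
    rw [← Complex.exp_nat_mul, ← Complex.exp_nat_mul, ← Complex.exp_nat_mul, ← Complex.exp_add,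
      ← Complex.exp_add, ← Complex.exp_sub]
    congr 1
    push_cast
    ring
  rw [e1, e2, e3, e6]
  rw [mul_pow, mul_pow, mul_pow, mul_mul_mul_comm, mul_mul_mul_comm (_ ^ 2),
    mul_div_mul_comm, ← e]
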